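/- Let $n\ge 2$ and let $(x_1,\dots,x_{n+1})$ be the canonical coordinates of Euclidean space $\mathbb R^{n+1}$, with canonical orthonormal basis $E_1,\dots,E_{n+1}$, flat connection $D$ and radial vector field $\vec r=\sum_i x_i\,\partial/\partial x_i$. For covariant $p$-tensor fields $T$ on $\mathbb R^{n+1}$ put - $\delta T(Y_1,\dots,Y_{p-1})=-\sum_i (D_{E_i}T)(E_i,Y_1,\dots,Y_{p-1})$, - $\Delta T=D^*DT=-\sum_i D_{E_i}D_{E_i}T$ (the Lichnerowicz Laplacian of the flat metric), - $\operatorname{Tr}T(Y_1,\dots,Y_{p-2})=\sum_i T(E_i,E_i,Y_1,\dots,Y_{p-2})$, - $\delta^*T(X_1,\dots,X_{p+1})=\sum_{j}(D_{X_j}T)(X_1,\dots,\widehat{X_j},\dots,X_{p+1})$, - $i_{\vec r}T(Y_1,\dots,Y_{p-1})=T(\vec r,Y_1,\dots,Y_{p-1})$, where $\delta$ and $i_{\vec r}$ are zero for $p=0$ and $\operatorname{Tr}$ is zero for $p\le 1$. For integers $p,k\ge 0$ let $\mathcal S^pP_k$ be the space of symmetric covariant $p$-tensor fields on $\mathbb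 R^{n+1}$ whose components in the coordinates are homogeneous polynomials of degree $k$, and let $$\mathcal S^pH_k^{\delta}=\mathcal S^pP_k\cap\operatorname{Ker}\Delta\cap\operatorname{Ker}\delta,\qquad \mathcal S^pH_k^{\delta 0}=\mathcal S^pH_k^{\delta}\cap\operatorname{Ker}\operatorname{Tr}.$$ By convention these three spaces are $0$ if $p<0$ or $k<0$. All these spaces are finite-dimensional, $$\dim\mathcal S^pP_k=\frac{(n+p)!}{n!\,p!}\,\frac{(n+k)!}{n!\,k!},$$ and for all integers $p,k\ge0$: 1. $\dim\mathcal S^pH_k^{\delta}=\dim\mathcal S^pP_k-\dim\mathcal S^pP_{k-2}-\dim\mathcal S^{p-1}P_{k-1}+\dim\mathcal S^{p-1}P_{k-3}$; 2. $\dim\mathcal S^pH_k^{\delta0}=\dim\mathcal S^pH_k^{\delta}-\dim\mathcal S^{p-2}H_k^{\delta}$; 3. $\dim(\mathcal S^pH_k^{\delta0}\cap\operatorname{Ker}\delta^*)=\dim\mathcal S^pH_k^{\delta0}-\dim\mathcal S^{p+1}H_{k-1}^{\delta0}$ if $k\le p$; 4. $\dim(\mathcal S^pH_k^{\delta0}\cap\operatorname{Ker}i_{\vec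 r})=\dim\mathcal S^pH_k^{\delta0}-\dim\mathcal S^{p-1}H_{k+1}^{\delta0}$ if $k\ge p$. Moreover, the following closed forms hold: $$\dim(\mathcal S^0H_k^{\delta0}\cap\operatorname{Ker}i_{\vec r})=\frac{(n+k-2)!\,(n+2k-1)}{k!\,(n-1)!}\quad(k\ge0),$$ $$\dim(\mathcal S^pH_0^{\delta0}\cap\operatorname{Ker}\delta^*)=\frac{(n+p-2)!\,(n+2p-1)}{p!\,(n-1)!}\quad(p\ge0),$$ $$\dim(\mathcal S^1H_k^{\delta0}\cap\operatorname{Ker}i_{\vec r})=\frac{(n+k-3)!\,k\,(n+2k-1)(n+k-1)}{(n-2)!\,(k+1)!}\quad(k\ge1),$$ $$\dim(\mathcal S^pH_1^{\delta0}\cap\operatorname{Ker}\delta^*)=\frac{(n+p-3)!\,p\,(n+2p-1)(n+p-1)}{(n-2)!\,(p+1)!}\quad(p\ge1),$$ $$\dim(\mathcal S^pH_k^{\delta0}\cap\operatorname{Ker}\delta^*)=\frac{(n+k-4)!\,(n+p-3)!\,(n+p+k-2)}{k!\,(p+1)!\,(n-1)!\,(n-2)!}\,(n-2)(n+2k-3)(n+2p-1)(p-k+1)\quad(2\le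 k\le p),$$ $$\dim(\mathcal S^pH_k^{\delta0}\cap\operatorname{Ker}i_{\vec r})=\frac{(n+k-3)!\,(n+p-4)!\,(n+p+k-2)}{(k+1)!\,p!\,(n-1)!\,(n-2)!}\,(n-2)(n+2k-1)(n+2p-3)(k-p+1)\quad(k\ge p\ge2).$$ -/

import Mathlib

open scoped ContDiff Nat

noncomputable section

namespace SphereTensor

/-- The Euclidean space `ℝⁿ⁺¹` containing the sphere `Sⁿ`. -/
abbrev E (n : ℕ) : Type := EuclideanSpace ℝ (Fin (n + 1))

/-- The canonical orthonormal basis `∂/∂xᵢ` of `ℝⁿ⁺¹`. -/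
def e (n : ℕ) (i : Fin (n + 1)) : E n := EuclideanSpace.single i (1 : ℝ)

/-- `Γ(⊗ᵖ T*ℝⁿ⁺¹)`: the smooth covariant `p`-tensor fields on `ℝⁿ⁺¹`. -/
def TensorField (n p : ℕ) : Submodule ℝ (E n → (E n [×p]→L[ℝ] ℝ)) where
  carrier := {T | ContDiff ℝ ∞ T}
  add_mem' := fun {S T} (hS : ContDiff ℝ ∞ S) (hT : ContDiff ℝ ∞ T) => hS.add hT
  zero_mem' := (contDiff_const : ContDiff ℝ ∞ fun _ : E n => (0 : E n [×p]→L[ℝ] ℝ))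
  smul_mem' := fun _ T (hT : ContDiff ℝ ∞ T) => contDiff_const.smul hT

theorem tensorField_contDiff {n p : ℕ} (T : TensorField n p) : ContDiff ℝ ∞ T.1 := T.2

theorem tensorField_differentiable {n p : ℕ} (T : TensorField n p) : Differentiable ℝ T.1 :=
  (tensorField_contDiff T).differentiable (by simp)

theorem contDiff_fderiv {n p : ℕ} (T : TensorField n p) : ContDiff ℝ ∞ (fderiv ℝ T.1) :=
  (tensorField_contDiff T).fderiv_right (by simp)

theorem fderiv_add_field {n p : ℕ} (S T : TensorField n p) (x : E n) :
    fderiv ℝ (S + T).1 x = fderiv ℝ S.1 x + fderiv ℝ T.1 x :=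
  fderiv_add (tensorField_differentiable S x) (tensorField_differentiable T x)

theorem fderiv_smul_field {n p : ℕ} (c : ℝ) (T : TensorField n p) (x : E n) :
    fderiv ℝ (c • T).1 x = c • fderiv ℝ T.1 x :=
  fderiv_const_smul (tensorField_differentiable T x) c

theorem contDiff_uncurryLeft {n p : ℕ} {A : E n → (E n →L[ℝ] (E n [×p]→L[ℝ] ℝ))}
    (hA : ContDiff ℝ ∞ A) : ContDiff ℝ ∞
      (fun x => (ContinuousLinearMap.uncurryLeft (Ei := fun _ => E n) (A x) :
        E n [×(p + 1)]→L[ℝ] ℝ)) := by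
  let L : (E n →L[ℝ] (E n [×p]→L[ℝ] ℝ)) →L[ℝ] (E n [×(p + 1)]→L[ℝ] ℝ) :=
    (continuousMultilinearCurryLeftEquiv ℝ
      (fun _ : Fin (p + 1) => E n) ℝ).symm.toContinuousLinearEquiv.toContinuousLinearMap
  exact L.contDiff.comp hA

theorem contDiff_curryLeft_apply {n p : ℕ} {T : E n → (E n [×(p + 1)]→L[ℝ] ℝ)} {v : E n → E n}
    (hT : ContDiff ℝ ∞ T) (hv : ContDiff ℝ ∞ v) :
    ContDiff ℝ ∞ (fun x => ((T x).curryLeft (v x) : E n [×p]→L[ℝ] ℝ)) := by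
  let L : (E n [×(p + 1)]→L[ℝ] ℝ) →L[ℝ] (E n →L[ℝ] (E n [×p]→L[ℝ] ℝ)) :=
    (continuousMultilinearCurryLeftEquiv ℝ
      (fun _ : Fin (p + 1) => E n) ℝ).toContinuousLinearEquiv.toContinuousLinearMap
  exact (L.contDiff.comp hT).clm_apply hv

/-- The derivative `D_X T` for the Levi-Civita connection of the flat metric, as a field whose first
argument is `X`: `(DT)(X, Y₁, …, Yₚ) = (D_X T)(Y₁, …, Yₚ)`. The connection being flat, `D_X T` is
the directional derivative of `T`. -/
def covD (n p : ℕ) : TensorField n p →ₗ[ℝ] TensorField n (p + 1) where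
  toFun T := ⟨fun x => ContinuousLinearMap.uncurryLeft (Ei := fun _ => E n) (fderiv ℝ T.1 x),
    contDiff_uncurryLeft (contDiff_fderiv T)⟩
  map_add' S T := by
    ext x v
    simp only [fderiv_add_field]
    rfl
  map_smul' c T := by
    ext x v
    simp only [fderiv_smul_field]
    rfl

theorem covD_apply {n p : ℕ} (T : TensorField n p) (x : E n) (X : Fin (p + 1) → E n) :
    (covD n p T).1 x X = fderiv ℝ T.1 x (X 0) (fun i => X i.succ) := rfl

/-- The formal adjoint `(D*T)(Y₁, …, Yₚ) = -∑ᵢ (D_{Eᵢ} T)(Eᵢ, Y₁, …, Yₚ)` of `covD`. -/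
def covDAdj (n p : ℕ) : TensorField n (p + 1) →ₗ[ℝ] TensorField n p where
  toFun T := ⟨fun x => -∑ i, (fderiv ℝ T.1 x (e n i)).curryLeft (e n i),
    ContDiff.neg (ContDiff.sum fun _ _ => contDiff_curryLeft_apply
      ((contDiff_fderiv T).clm_apply contDiff_const) contDiff_const)⟩
  map_add' S T := by
    refine Subtype.ext (funext fun x => ContinuousMultilinearMap.ext fun v => ?_)
    have h : fderiv ℝ (S.1 + T.1) x = fderiv ℝ S.1 x + fderiv ℝ T.1 x := fderiv_add_field S T x
    change (-∑ i, (fderiv ℝ (S.1 + T.1) x (e n i)).curryLeft (e n i)) v =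
      (-∑ i, (fderiv ℝ S.1 x (e n i)).curryLeft (e n i)) v +
      (-∑ i, (fderiv ℝ T.1 x (e n i)).curryLeft (e n i)) v
    rw [h]
    simp [Finset.sum_add_distrib, add_comm]
  map_smul' c T := by
    refine Subtype.ext (funext fun x => ContinuousMultilinearMap.ext fun v => ?_)
    have h : fderiv ℝ (c • T.1) x = c • fderiv ℝ T.1 x := fderiv_smul_field c T x
    change (-∑ i, (fderiv ℝ (c • T.1) x (e n i)).curryLeft (e n i)) v =
      c • (-∑ i, (fderiv ℝ T.1 x (e n i)).curryLeft (e n i)) v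
    rw [h]
    simp [Finset.mul_sum]

theorem covDAdj_apply {n p : ℕ} (T : TensorField n (p + 1)) (x : E n) (Y : Fin p → E n) :
    (covDAdj n p T).1 x Y =
      -∑ i, fderiv ℝ T.1 x (e n i) (Fin.cons (e n i) Y : Fin (p + 1) → E n) := by
  simp [covDAdj]

/-- The Lichnerowicz Laplacian `D*D + R(T)` of `ℝⁿ⁺¹`; the curvature term `R(T)` is zero because the
metric is flat. -/
def lichLaplacian (n p : ℕ) : TensorField n p →ₗ[ℝ] TensorField n p :=
  covDAdj n p ∘ₗ covD n p

/-- The divergence `δ`, that is `D*`, in all degrees; it is zero on functions. -/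
def divergence (n : ℕ) : (p : ℕ) → (TensorField n p →ₗ[ℝ] TensorField n (p - 1))
  | 0 => 0
  | p + 1 => covDAdj n p

/-- The trace `(Tr T)(X₁, …) = ∑ⱼ T(Eⱼ, Eⱼ, X₁, …)`; it is zero in degrees `0` and `1`. -/
def trace (n : ℕ) : (p : ℕ) → (TensorField n p →ₗ[ℝ] TensorField n (p - 2))
  | 0 => 0
  | 1 => 0
  | p + 2 =>
    { toFun := fun T => ⟨fun x => ∑ j, ((T.1 x).curryLeft (e n j)).curryLeft (e n j),
        ContDiff.sum fun _ _ => contDiff_curryLeft_apply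
          (contDiff_curryLeft_apply (tensorField_contDiff T) contDiff_const) contDiff_const⟩
      map_add' := fun S T => by
        refine Subtype.ext (funext fun x => ContinuousMultilinearMap.ext fun v => ?_)
        simp [Finset.sum_add_distrib]
      map_smul' := fun c T => by
        refine Subtype.ext (funext fun x => ContinuousMultilinearMap.ext fun v => ?_)
        simp [Finset.mul_sum] }

theorem trace_apply {n p : ℕ} (T : TensorField n (p + 2)) (x : E n) (X : Fin p → E n) :
    (trace n (p + 2) T).1 x X =
      ∑ j, T.1 x (Fin.cons (e n j) (Fin.cons (e n j) X : Fin (p + 1) → E n)) := by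
  simp [trace]

/-- Contraction `i_r` with the radial field `r = ∑ᵢ xᵢ ∂/∂xᵢ`, whose value at `x` is `x`:
`(i_r T)ₓ(X₁, …) = Tₓ(x, X₁, …)`; it is zero on functions. -/
def radialContr (n : ℕ) : (p : ℕ) → (TensorField n p →ₗ[ℝ] TensorField n (p - 1))
  | 0 => 0
  | _ + 1 =>
    { toFun := fun T => ⟨fun x => (T.1 x).curryLeft x,
        contDiff_curryLeft_apply (tensorField_contDiff T) contDiff_id⟩
      map_add' := fun S T => by
        refine Subtype.ext (funext fun x => ContinuousMultilinearMap.ext fun v => ?_)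
        simp
      map_smul' := fun c T => by
        refine Subtype.ext (funext fun x => ContinuousMultilinearMap.ext fun v => ?_)
        simp }

theorem radialContr_apply {n p : ℕ} (T : TensorField n (p + 1)) (x : E n) (X : Fin p → E n) :
    (radialContr n (p + 1) T).1 x X = T.1 x (Fin.cons x X : Fin (p + 1) → E n) := rfl

theorem contDiff_domDomCongr {n p : ℕ} {T : E n → (E n [×p]→L[ℝ] ℝ)} (σ : Equiv.Perm (Fin p))
    (hT : ContDiff ℝ ∞ T) : ContDiff ℝ ∞ (fun x => (T x).domDomCongr σ) :=
  (ContinuousLinearMap.contDiff (ContinuousMultilinearMap.domDomCongrₗᵢ ℝ (E n) ℝ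
    σ).toContinuousLinearEquiv.toContinuousLinearMap).comp hT

/-- The symmetrized derivative
`(δ*T)(X₁, …, Xₚ₊₁) = ∑ⱼ (D_{Xⱼ} T)(X₁, …, X̂ⱼ, …, Xₚ₊₁)`; see `symDeriv_apply`. -/
def symDeriv (n p : ℕ) : TensorField n p →ₗ[ℝ] TensorField n (p + 1) where
  toFun T := ⟨fun x => ∑ j : Fin (p + 1), ((covD n p T).1 x).domDomCongr j.cycleRange.symm,
    ContDiff.sum (f := fun (j : Fin (p + 1)) x =>
      ((covD n p T).1 x).domDomCongr j.cycleRange.symm) fun j _ =>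
        contDiff_domDomCongr j.cycleRange.symm (tensorField_contDiff (covD n p T))⟩
  map_add' S T := by
    refine Subtype.ext (funext fun x => ContinuousMultilinearMap.ext fun v => ?_)
    simp only [map_add]
    simp [Finset.sum_add_distrib]
  map_smul' c T := by
    refine Subtype.ext (funext fun x => ContinuousMultilinearMap.ext fun v => ?_)
    simp only [map_smul]
    simp [Finset.mul_sum]

theorem symDeriv_apply {n p : ℕ} (T : TensorField n p) (x : E n) (X : Fin (p + 1) → E n) :
    (symDeriv n p T).1 x X = ∑ j, fderiv ℝ T.1 x (X j) (j.removeNth X) := by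
  have h : (symDeriv n p T).1 x X = ∑ j : Fin (p + 1),
      fderiv ℝ T.1 x (X (j.cycleRange.symm 0)) (fun i => X (j.cycleRange.symm i.succ)) := by
    change (∑ j : Fin (p + 1),
      ((fderiv ℝ T.1 x).uncurryLeft).domDomCongr j.cycleRange.symm) X = _
    rw [sum_apply]
    rfl
  rw [h]
  refine Finset.sum_congr rfl fun j _ => ?_
  simp only [Fin.cycleRange_symm_zero, Fin.cycleRange_symm_succ]
  rfl

/-- `𝒮ᵖ(ℝⁿ⁺¹)`: the symmetric covariant `p`-tensor fields. -/
def SymField (n p : ℕ) : Submodule ℝ (TensorField n p) where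
  carrier := {T | ∀ (x : E n) (σ : Equiv.Perm (Fin p)) (X : Fin p → E n),
    T.1 x (fun i => X (σ i)) = T.1 x X}
  add_mem' := fun hS hT x σ X => by simp [hS x σ X, hT x σ X]
  zero_mem' := fun _ _ _ => rfl
  smul_mem' := fun c T hT x σ X => by simp [hT x σ X]

/-- `𝒮ᵖPₖ`: the symmetric tensor fields whose components in the coordinates `(x₁, …, xₙ₊₁)` are
homogeneous polynomials of degree `k`. -/
def SP (n p k : ℕ) : Submodule ℝ (TensorField n p) where
  carrier := {T | T ∈ SymField n p ∧ ∀ i : Fin p → Fin (n + 1),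
    ∃ P : MvPolynomial (Fin (n + 1)) ℝ, P.IsHomogeneous k ∧
      ∀ x : E n, T.1 x (fun j => e n (i j)) = MvPolynomial.eval (fun l => x l) P}
  add_mem' := fun {S T} hS hT => ⟨Submodule.add_mem _ hS.1 hT.1, fun i => by
    obtain ⟨P, hP, hP'⟩ := hS.2 i
    obtain ⟨Q, hQ, hQ'⟩ := hT.2 i
    exact ⟨P + Q, hP.add hQ, fun x => by simp [hP', hQ']⟩⟩
  zero_mem' := ⟨Submodule.zero_mem _, fun _ =>
    ⟨0, MvPolynomial.isHomogeneous_zero _ _ _, fun x => by simp⟩⟩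
  smul_mem' := fun c T hT => ⟨Submodule.smul_mem _ c hT.1, fun i => by
    obtain ⟨P, hP, hP'⟩ := hT.2 i
    exact ⟨c • P, (MvPolynomial.homogeneousSubmodule _ ℝ k).smul_mem c hP,
      fun x => by simp [hP']⟩⟩

/-- `𝒮ᵖHₖ^δ = 𝒮ᵖPₖ ∩ Ker Δ ∩ Ker δ`. -/
def SHδ (n p k : ℕ) : Submodule ℝ (TensorField n p) :=
  SP n p k ⊓ LinearMap.ker (lichLaplacian n p) ⊓ LinearMap.ker (divergence n p)

/-- `𝒮ᵖHₖ^{δ0} = 𝒮ᵖHₖ^δ ∩ Ker Tr`. -/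
def SHδ0 (n p k : ℕ) : Submodule ℝ (TensorField n p) :=
  SHδ n p k ⊓ LinearMap.ker (trace n p)

/-- `𝒮ᵖHₖ^{δ0} ∩ Ker δ*`. -/
def SHδ0KerSymDeriv (n p k : ℕ) : Submodule ℝ (TensorField n p) :=
  SHδ0 n p k ⊓ LinearMap.ker (symDeriv n p)

/-- `𝒮ᵖHₖ^{δ0} ∩ Ker i_r`. -/
def SHδ0KerRadial (n p k : ℕ) : Submodule ℝ (TensorField n p) :=
  SHδ0 n p k ⊓ LinearMap.ker (radialContr n p)

/-- The dimension of the space `S p k` for integer indices, with the convention that the space is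
zero when `p < 0` or `k < 0`. -/
def dimZ {n : ℕ} (S : (p : ℕ) → ℕ → Submodule ℝ (TensorField n p)) (p k : ℤ) : ℤ :=
  if 0 ≤ p ∧ 0 ≤ k then (Module.finrank ℝ (S p.toNat k.toNat) : ℤ) else 0

end SphereTensor

end

/-! A symmetric `p`-tensor field with components homogeneous of degree `k` is the same thing as a
polynomial `F(x, y)` of degree `p` in `y` and `k` in `x`: its components are the `p`-fold
`y`-derivatives of `F` (`map_fieldOf_bihom`). In this dictionary `Δ`, `δ`, `Tr` become `-∑ ∂²/∂xᵢ²`,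
`-∑ ∂²/∂xᵢ∂yᵢ`, `∑ ∂²/∂yᵢ²`, while `δ*` and `i_r` become `raise = ∑ yᵢ ∂/∂xᵢ` and `lower = ∑ xᵢ
∂/∂yᵢ`.

The three second-order operators commute, and formulas 1 and 2 are rank-nullity once each is known
to be surjective between the kernels of the preceding ones (`exists_lapX_eq`, `exists_lapXY_eq`,
`exists_lapY_eq`). Three distinct indices `a`, `b`, `c` exist because `n + 1 ≥ 3`. A weight on the
variables makes `∂²/∂xₐ²`, `∂²/∂x_c∂y_c`, `∂²/∂y_b²` the leading terms; these are inverted by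
integration, and the error lies deeper in a filtration that is eventually zero.

For formulas 3 and 4, `raise` and `lower` generate an action of `𝔰𝔩₂` on the joint kernels `Harm`,
with weight `p - k`, and both act nilpotently. By `exists_raise_lower_eq`, `raise` is onto a space
of positive weight and `lower` onto one of negative weight; `k ≤ p`, respectively `p ≤ k`, ensures
this sign.

Finally `dim Harm = h_p h_k - h_{p-1} h_{k-1}`, where `h_k` is the dimension of the harmonic
polynomials of degree `k` (`finrank_harm_eq`), and the closed forms are factorial identities. -/

noncomputable section

namespace SphereTensor

open MvPolynomial

/-! ### Solving an equation by successive approximation along a filtration. -/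

section Approximation

/-- Successive approximation: an operator that can be inverted up to terms which are deeper in a
filtration that is eventually zero is surjective. -/
theorem exists_solution_of_approx {M : Type*} [AddCommGroup M] [Module ℝ M]
    (T : M →ₗ[ℝ] M) (V W : ℤ → Submodule ℝ M) (L K : Submodule ℝ M) (N : ℤ)
    (hV : ∀ w, N < w → V w = ⊥) (hW : Antitone W)
    (h : ∀ w, ∀ f ∈ V w ⊓ L, ∃ u ∈ W w ⊓ K, f - T u ∈ V (w + 1) ⊓ L) (w : ℤ) :
    ∀ f ∈ V w ⊓ L, ∃ u ∈ W w ⊓ K, T u = f := by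
  -- `j` bounds the number of corrections left before `V` vanishes; at `j = 0` the level `w` already
  -- exceeds `N`.
  have key : ∀ (j : ℕ) (w : ℤ), N - w < j → ∀ f ∈ V w ⊓ L, ∃ u ∈ W w ⊓ K, T u = f := by
    intro j
    induction j with
    | zero =>
      intro w hw f hf
      have : f = 0 := by
        have := hf.1
        rwa [hV w (by simpa using hw), SetLike.mem_coe, Submodule.mem_bot] at this
      exact ⟨0, Submodule.zero_mem _, by simp [this]⟩
    | succ j ih =>
      intro w hw f hf
      obtain ⟨u, hu, hu'⟩ := h w f hf
      obtain ⟨v, hv, hv'⟩ := ih (w + 1) (by push_cast at hw; linarith) _ hu'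
      exact ⟨u + v, Submodule.add_mem _ hu ⟨hW (by linarith) hv.1, hv.2⟩, by simp [hv']⟩
  exact key (N - w + 1).toNat w (by have := Int.self_le_toNat (N - w + 1); linarith)

end Approximation

/-! ### Bigraded polynomials in `x` and `y`, filtered by a weight; with integer degrees, negative
ones give the zero space. -/

section Filtration

variable {ι : Type*}

/-- Polynomials in two vectors of variables, `x` (left) and `y` (right). -/
abbrev BiPoly (ι : Type*) : Type _ := MvPolynomial (ι ⊕ ι) ℝ

/-- Partial derivative as a linear endomorphism. -/
def pd (s : ι ⊕ ι) : Module.End ℝ (BiPoly ι) := (pderiv s).toLinearMap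

/-- Multiplication by a variable. -/
def mulX (s : ι ⊕ ι) : Module.End ℝ (BiPoly ι) := LinearMap.mulLeft ℝ (X s)

/-- Formal antiderivative in one variable. -/
def integ (s : ι ⊕ ι) : Module.End ℝ (BiPoly ι) :=
  (basisMonomials (ι ⊕ ι) ℝ).constr ℝ
    fun m => monomial (m + Finsupp.single s 1) (1 / ((m s : ℝ) + 1))

theorem pd_apply (s : ι ⊕ ι) (F : BiPoly ι) : pd s F = pderiv s F := rfl

theorem mulX_apply (s : ι ⊕ ι) (F : BiPoly ι) : mulX s F = X s * F := rfl

theorem integ_monomial (s : ι ⊕ ι) (m : ι ⊕ ι →₀ ℕ) :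
    integ s (monomial m 1) = monomial (m + Finsupp.single s 1) (1 / ((m s : ℝ) + 1)) := by
  have := (basisMonomials (ι ⊕ ι) ℝ).constr_basis ℝ
    (fun m => (monomial (m + Finsupp.single s 1) (1 / ((m s : ℝ) + 1)) : BiPoly ι)) m
  simpa [integ] using this

theorem end_ext {S T : Module.End ℝ (BiPoly ι)}
    (h : ∀ m, S (monomial m 1) = T (monomial m 1)) : S = T :=
  (basisMonomials (ι ⊕ ι) ℝ).ext fun m => by simpa using h m

theorem monomial_eq_smul (m : ι ⊕ ι →₀ ℕ) (a : ℝ) :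
    (monomial m a : BiPoly ι) = a • monomial m 1 := by simp [smul_monomial]

theorem pd_comm (s t : ι ⊕ ι) : pd s * pd t = pd t * pd s := by
  refine end_ext fun m => ?_
  classical
  ext d
  simp only [Module.End.mul_apply, pd_apply, coeff_pderiv]
  rw [add_right_comm]
  by_cases h : s = t
  · subst h; ring
  · simp [h, Ne.symm h]
    ring_nf

theorem pd_mul_integ_self (s : ι ⊕ ι) : pd s * integ s = 1 := by
  refine end_ext fun m => ?_
  have : (m s : ℝ) + 1 ≠ 0 := by positivity
  simp [pd_apply, integ_monomial, this]

theorem pd_mul_integ_of_ne {s t : ι ⊕ ι} (h : s ≠ t) : pd s * integ t = integ t * pd s := by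
  refine end_ext fun m => ?_
  classical
  simp only [Module.End.mul_apply, pd_apply, integ_monomial, pderiv_monomial]
  rw [monomial_eq_smul (m - _), map_smul, integ_monomial]
  by_cases hm : m s = 0
  · simp [hm, h]
  have : m + Finsupp.single t 1 - Finsupp.single s 1 = m - Finsupp.single s 1 + Finsupp.single t 1 := by
    ext u
    by_cases hu : u = s
    · subst hu; simp [h.symm]
    · simp [Ne.symm hu]
  rw [this, smul_monomial]
  simp [h, h.symm]
  ring_nf

theorem pd_mul_mulX_of_ne {s t : ι ⊕ ι} (h : s ≠ t) : pd s * mulX t = mulX t * pd s := by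
  refine LinearMap.ext fun F => ?_
  simp [pd_apply, mulX_apply, pderiv_X_of_ne h.symm]

theorem pd_mul_mulX_self (s : ι ⊕ ι) : pd s * mulX s = mulX s * pd s + 1 := by
  refine LinearMap.ext fun F => ?_
  simp [pd_apply, mulX_apply]

theorem pd_mul_mulX [DecidableEq ι] (s t : ι ⊕ ι) :
    pd s * mulX t = mulX t * pd s + if s = t then 1 else 0 := by
  split_ifs with h
  · rw [h, pd_mul_mulX_self]
  · rw [pd_mul_mulX_of_ne h, add_zero]

/-- The weight counting the degree in `x`. -/
def wx : ι ⊕ ι → ℤ := Sum.elim 1 0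

/-- The weight counting the degree in `y`. -/
def wy : ι ⊕ ι → ℤ := Sum.elim 0 1

/-- Polynomials of degree `p` in `y` and `k` in `x` all of whose monomials have `ν`-weight at
least `w`. -/
def Filt (ν : ι ⊕ ι → ℤ) (p k w : ℤ) : Submodule ℝ (BiPoly ι) :=
  restrictSupport ℝ {m | Finsupp.weight wy m = p ∧ Finsupp.weight wx m = k ∧
    w ≤ Finsupp.weight ν m}

variable {ν : ι ⊕ ι → ℤ} {p k w p' k' w' : ℤ}

theorem monomial_mem_filt {m : ι ⊕ ι →₀ ℕ} {a : ℝ} (h : a ≠ 0 → Finsupp.weight wy m = p ∧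
    Finsupp.weight wx m = k ∧ w ≤ Finsupp.weight ν m) : monomial m a ∈ Filt ν p k w := by
  by_cases ha : a = 0
  · simp [ha]
  · exact (monomial_mem_restrictSupport ℝ).2 (Or.inl (h ha))

/-- `Filt` is spanned by monomials, so membership claims and linear identities on it need only be
tested there. -/
theorem map_mem_filt {N : Type*} [AddCommGroup N] [Module ℝ N] {T : BiPoly ι →ₗ[ℝ] N}
    {W : Submodule ℝ N}
    (h : ∀ m : ι ⊕ ι →₀ ℕ, Finsupp.weight wy m = p → Finsupp.weight wx m = k →
      w ≤ Finsupp.weight ν m → T (monomial m 1) ∈ W) {F : BiPoly ι} (hF : F ∈ Filt ν p k w) :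
    T F ∈ W := by
  have : Filt ν p k w ≤ W.comap T := by
    rw [Filt, restrictSupport_eq_span, Submodule.span_le]
    rintro _ ⟨m, hm, rfl⟩
    exact h m hm.1 hm.2.1 hm.2.2
  exact this hF

theorem filt_mono (h : w' ≤ w) : Filt ν p k w ≤ Filt ν p k w' :=
  restrictSupport_mono _ fun _ hm => ⟨hm.1, hm.2.1, h.trans hm.2.2⟩

theorem pd_mem_filt (s : ι ⊕ ι) (hp : p' = p - wy s) (hk : k' = k - wx s) (hw : w' ≤ w - ν s)
    {F : BiPoly ι} (hF : F ∈ Filt ν p k w) : pd s F ∈ Filt ν p' k' w' := by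
  refine map_mem_filt (fun m h1 h2 h3 => ?_) hF
  rw [pd_apply, pderiv_monomial]
  refine monomial_mem_filt fun h => ?_
  have hs : m s ≠ 0 := by
    intro h'; simp [h'] at h
  have e1 := Finsupp.weight_sub_single_add (w := wy) hs
  have e2 := Finsupp.weight_sub_single_add (w := wx) hs
  have e3 := Finsupp.weight_sub_single_add (w := ν) hs
  refine ⟨?_, ?_, ?_⟩ <;> linarith

theorem integ_mem_filt (s : ι ⊕ ι) (hp : p' = p + wy s) (hk : k' = k + wx s)
    (hw : w' ≤ w + ν s) {F : BiPoly ι} (hF : F ∈ Filt ν p k w) : integ s F ∈ Filt ν p' k' w' := by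
  refine map_mem_filt (fun m h1 h2 h3 => ?_) hF
  rw [integ_monomial]
  refine monomial_mem_filt fun h => ?_
  simp only [map_add, Finsupp.weight_single, one_smul]
  refine ⟨?_, ?_, ?_⟩ <;> linarith

theorem mulX_mem_filt (s : ι ⊕ ι) (hp : p' = p + wy s) (hk : k' = k + wx s)
    (hw : w' ≤ w + ν s) {F : BiPoly ι} (hF : F ∈ Filt ν p k w) : mulX s F ∈ Filt ν p' k' w' := by
  refine map_mem_filt (fun m h1 h2 h3 => ?_) hF
  rw [mulX_apply, X, monomial_mul]
  refine monomial_mem_filt fun h => ?_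
  simp only [map_add, Finsupp.weight_single, one_smul]
  refine ⟨?_, ?_, ?_⟩ <;> linarith

theorem weight_mono {ν ν' : ι ⊕ ι → ℤ} (h : ∀ s, ν s ≤ ν' s) (m : ι ⊕ ι →₀ ℕ) :
    Finsupp.weight ν m ≤ Finsupp.weight ν' m := by
  rw [Finsupp.weight_apply, Finsupp.weight_apply]
  exact Finset.sum_le_sum fun s _ => nsmul_le_nsmul_right (h s) _

theorem weight_nonneg (h : ∀ s, 0 ≤ ν s) (m : ι ⊕ ι →₀ ℕ) : 0 ≤ Finsupp.weight ν m := by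
  rw [Finsupp.weight_apply]
  exact Finset.sum_nonneg fun s _ => nsmul_nonneg (h s) _

theorem wx_nonneg (s : ι ⊕ ι) : 0 ≤ wx s := by cases s <;> simp [wx]

theorem wy_nonneg (s : ι ⊕ ι) : 0 ≤ wy s := by cases s <;> simp [wy]

theorem filt_eq_bot (h : ∀ m : ι ⊕ ι →₀ ℕ, Finsupp.weight wy m = p → Finsupp.weight wx m = k →
    ¬ w ≤ Finsupp.weight ν m) : Filt ν p k w = ⊥ := by
  rw [eq_bot_iff]
  intro F hF
  have := map_mem_filt (T := (LinearMap.id : BiPoly ι →ₗ[ℝ] BiPoly ι)) (W := ⊥) (fun m h1 h2 h3 => absurd h3 (h m h1 h2)) hF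
  exact this

theorem weight_le_of_le {c : ℤ} (h : ∀ s, ν s ≤ c) (m : ι ⊕ ι →₀ ℕ) :
    Finsupp.weight ν m ≤ c * (Finsupp.weight wy m + Finsupp.weight wx m) := by
  have h1 := weight_mono (ν := ν) (ν' := fun _ => c) h m
  refine h1.trans (le_of_eq ?_)
  simp only [Finsupp.weight_apply, Finsupp.sum, ← Finset.sum_add_distrib, Finset.mul_sum]
  refine Finset.sum_congr rfl fun s _ => ?_
  cases s <;> simp [wx, wy] <;> ring

theorem filt_eq_bot_of_lt {c : ℤ} (h : ∀ s, ν s ≤ c) (hw : c * (p + k) < w) :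
    Filt ν p k w = ⊥ :=
  filt_eq_bot fun m h1 h2 => by
    have := weight_le_of_le h m
    rw [h1, h2] at this
    linarith

/-- Polynomials of degree `p` in `y` and `k` in `x`. -/
def Bihom (ι : Type*) (p k : ℤ) : Submodule ℝ (BiPoly ι) := Filt 0 p k 0

/-- A nonnegative weight imposes no condition at level `0`, so filtered solutions can be read as
statements about `Bihom`. -/
theorem bihom_eq_filt (h : ∀ s, 0 ≤ ν s) : Bihom ι p k = Filt ν p k 0 := by
  unfold Bihom Filt
  congr 1
  ext m
  simp [weight_nonneg h, weight_nonneg (ν := (0 : ι ⊕ ι → ℤ)) (by simp)]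

theorem pd_mem_bihom (s : ι ⊕ ι) (hp : p' = p - wy s) (hk : k' = k - wx s)
    {F : BiPoly ι} (hF : F ∈ Bihom ι p k) : pd s F ∈ Bihom ι p' k' :=
  pd_mem_filt s hp hk (by simp) hF

theorem mulX_mem_bihom (s : ι ⊕ ι) (hp : p' = p + wy s) (hk : k' = k + wx s)
    {F : BiPoly ι} (hF : F ∈ Bihom ι p k) : mulX s F ∈ Bihom ι p' k' :=
  mulX_mem_filt s hp hk (by simp) hF

theorem bihom_eq_bot_left (h : p < 0) : Bihom ι p k = ⊥ :=
  filt_eq_bot fun m h1 _ _ => by have := weight_nonneg wy_nonneg m; omega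

theorem bihom_eq_bot_right (h : k < 0) : Bihom ι p k = ⊥ :=
  filt_eq_bot fun m _ h1 _ => by have := weight_nonneg wx_nonneg m; omega

end Filtration

/-! ### The three commuting second-order operators. -/

section Operators

variable {ι : Type*} {ν : ι ⊕ ι → ℤ} {p k w p' k' w' : ℤ}

theorem pd_pd_mem_filt (s t : ι ⊕ ι) (hp : p' = p - wy s - wy t) (hk : k' = k - wx s - wx t)
    (hw : w' ≤ w - ν s - ν t) {F : BiPoly ι} (hF : F ∈ Filt ν p k w) :
    (pd s * pd t) F ∈ Filt ν p' k' w' :=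
  pd_mem_filt (p := p - wy t) (k := k - wx t) (w := w - ν t) s (by rw [hp]; ring)
    (by rw [hk]; ring) (hw.trans (by linarith)) (pd_mem_filt t rfl rfl le_rfl hF)

theorem integ_integ_mem_filt (s t : ι ⊕ ι) (hp : p' = p + wy s + wy t) (hk : k' = k + wx s + wx t)
    (hw : w' ≤ w + ν s + ν t) {F : BiPoly ι} (hF : F ∈ Filt ν p k w) :
    (integ s * integ t) F ∈ Filt ν p' k' w' :=
  integ_mem_filt (p := p + wy t) (k := k + wx t) (w := w + ν t) s (by rw [hp]; ring)
    (by rw [hk]; ring) (hw.trans (by linarith)) (integ_mem_filt t rfl rfl le_rfl hF)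

theorem sum_pd_pd_mem_filt (S : Finset ι) (s t : ι → ι ⊕ ι)
    (hp : ∀ i ∈ S, p' = p - wy (s i) - wy (t i)) (hk : ∀ i ∈ S, k' = k - wx (s i) - wx (t i))
    (hw : ∀ i ∈ S, w' ≤ w - ν (s i) - ν (t i)) {F : BiPoly ι} (hF : F ∈ Filt ν p k w) :
    (∑ i ∈ S, pd (s i) * pd (t i)) F ∈ Filt ν p' k' w' := by
  rw [LinearMap.sum_apply]
  exact Submodule.sum_mem _ fun i hi => pd_pd_mem_filt _ _ (hp i hi) (hk i hi) (hw i hi) hF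

theorem commute_pd (s t : ι ⊕ ι) : Commute (pd s) (pd t) := pd_comm s t

theorem commute_pd_integ {s t : ι ⊕ ι} (h : s ≠ t) : Commute (pd s) (integ t) :=
  pd_mul_integ_of_ne h

theorem pd_pd_integ_integ {s t : ι ⊕ ι} (F : BiPoly ι) :
    (pd s * pd t) ((integ t * integ s) F) = F := by
  have : pd s * pd t * (integ t * integ s) = 1 := by
    rw [mul_assoc, ← mul_assoc (pd t), pd_mul_integ_self, one_mul, pd_mul_integ_self]
  rw [← Module.End.mul_apply, this, Module.End.one_apply]

theorem pd_pd_integ_integ_comm {s t s' t' : ι ⊕ ι} (h1 : s ≠ s') (h2 : s ≠ t') (h3 : t ≠ s')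
    (h4 : t ≠ t') (F : BiPoly ι) :
    (pd s * pd t) ((integ s' * integ t') F) = (integ s' * integ t') ((pd s * pd t) F) := by
  have : Commute (pd s * pd t) (integ s' * integ t') :=
    ((commute_pd_integ h1).mul_right (commute_pd_integ h2)).mul_left
      ((commute_pd_integ h3).mul_right (commute_pd_integ h4))
  rw [← Module.End.mul_apply, this.eq, Module.End.mul_apply]

variable [Fintype ι]

/-- The Laplacian `∑ ∂²/∂xᵢ²`. -/
def lapX : Module.End ℝ (BiPoly ι) := ∑ i, pd (Sum.inl i) * pd (Sum.inl i)

/-- The mixed operator `∑ ∂²/∂xᵢ∂yᵢ`. -/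
def lapXY : Module.End ℝ (BiPoly ι) := ∑ i, pd (Sum.inl i) * pd (Sum.inr i)

/-- The Laplacian `∑ ∂²/∂yᵢ²`. -/
def lapY : Module.End ℝ (BiPoly ι) := ∑ i, pd (Sum.inr i) * pd (Sum.inr i)

theorem commute_lapX_lapXY : Commute (lapX (ι := ι)) lapXY :=
  Commute.sum_left _ _ _ fun _ _ => Commute.sum_right _ _ _ fun _ _ =>
    ((commute_pd _ _).mul_right (commute_pd _ _)).mul_left
      ((commute_pd _ _).mul_right (commute_pd _ _))

theorem commute_lapX_lapY : Commute (lapX (ι := ι)) lapY :=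
  Commute.sum_left _ _ _ fun _ _ => Commute.sum_right _ _ _ fun _ _ =>
    ((commute_pd _ _).mul_right (commute_pd _ _)).mul_left
      ((commute_pd _ _).mul_right (commute_pd _ _))

theorem commute_lapXY_lapY : Commute (lapXY (ι := ι)) lapY :=
  Commute.sum_left _ _ _ fun _ _ => Commute.sum_right _ _ _ fun _ _ =>
    ((commute_pd _ _).mul_right (commute_pd _ _)).mul_left
      ((commute_pd _ _).mul_right (commute_pd _ _))

theorem lapX_lapXY (F : BiPoly ι) : lapX (lapXY F) = lapXY (lapX F) :=
  LinearMap.congr_fun commute_lapX_lapXY.eq F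

theorem lapX_lapY (F : BiPoly ι) : lapX (lapY F) = lapY (lapX F) :=
  LinearMap.congr_fun commute_lapX_lapY.eq F

theorem lapXY_lapY (F : BiPoly ι) : lapXY (lapY F) = lapY (lapXY F) :=
  LinearMap.congr_fun commute_lapXY_lapY.eq F

end Operators

/-! ### Successive surjectivity of the three operators. -/

section Surjectivity

variable {ι : Type*} [DecidableEq ι] {p k w : ℤ}

/-- The weight for which `∂²/∂xₐ²`, `∂²/∂x_c∂y_c` and `∂²/∂y_b²` are the leading terms of the three
operators. -/
def leadWeight (a b c : ι) : ι ⊕ ι → ℤ :=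
  Sum.elim (fun i => if i = a then 3 else if i = c then 2 else 0)
    (fun i => if i = b then 3 else if i = c then 2 else 0)

theorem leadWeight_nonneg (a b c : ι) (s : ι ⊕ ι) : 0 ≤ leadWeight a b c s := by
  cases s <;> simp only [leadWeight, Sum.elim_inl, Sum.elim_inr] <;> split_ifs <;> norm_num

theorem leadWeight_le (a b c : ι) (s : ι ⊕ ι) : leadWeight a b c s ≤ 3 := by
  cases s <;> simp only [leadWeight, Sum.elim_inl, Sum.elim_inr] <;> split_ifs <;> norm_num

theorem leadWeight_inl_self (a b c : ι) : leadWeight a b c (Sum.inl a) = 3 := by simp [leadWeight]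

theorem leadWeight_inr_self (a b c : ι) : leadWeight a b c (Sum.inr b) = 3 := by simp [leadWeight]

theorem leadWeight_inl_le {a b c i : ι} (h : i ≠ a) : leadWeight a b c (Sum.inl i) ≤ 2 := by
  simp only [leadWeight, Sum.elim_inl, h, if_false]; split_ifs <;> norm_num

theorem leadWeight_inr_le {a b c i : ι} (h : i ≠ b) : leadWeight a b c (Sum.inr i) ≤ 2 := by
  simp only [leadWeight, Sum.elim_inr, h, if_false]; split_ifs <;> norm_num

theorem filt_leadWeight_eq_bot (a b c : ι) (w : ℤ) (hw : 3 * (p + k) < w) :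
    Filt (leadWeight a b c) p k w = ⊥ :=
  filt_eq_bot_of_lt (leadWeight_le a b c) hw

variable [Fintype ι]

theorem lapX_eq (a : ι) : lapX = pd (Sum.inl a) * pd (Sum.inl a) +
    ∑ i ∈ Finset.univ.erase a, pd (Sum.inl i) * pd (Sum.inl i) :=
  (Finset.add_sum_erase _ (fun i => pd (Sum.inl i) * pd (Sum.inl i)) (Finset.mem_univ a)).symm

theorem lapXY_eq (a : ι) : lapXY = pd (Sum.inl a) * pd (Sum.inr a) +
    ∑ i ∈ Finset.univ.erase a, pd (Sum.inl i) * pd (Sum.inr i) :=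
  (Finset.add_sum_erase _ (fun i => pd (Sum.inl i) * pd (Sum.inr i)) (Finset.mem_univ a)).symm

theorem lapY_eq (a : ι) : lapY = pd (Sum.inr a) * pd (Sum.inr a) +
    ∑ i ∈ Finset.univ.erase a, pd (Sum.inr i) * pd (Sum.inr i) :=
  (Finset.add_sum_erase _ (fun i => pd (Sum.inr i) * pd (Sum.inr i)) (Finset.mem_univ a)).symm

variable {a b c : ι} {F : BiPoly ι}

theorem lapX_tail_mem (hF : F ∈ Filt (leadWeight a b c) p k w) :
    (∑ i ∈ Finset.univ.erase a, pd (Sum.inl i) * pd (Sum.inl i)) F ∈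
      Filt (leadWeight a b c) p (k - 2) (w - 4) :=
  sum_pd_pd_mem_filt _ _ _ (fun i _ => by simp [wy]) (fun i _ => by simp [wx]; ring)
    (fun i hi => by
      have := leadWeight_inl_le (b := b) (c := c) (Finset.ne_of_mem_erase hi)
      linarith) hF

/-- For `i ≠ c` the weights of `xᵢ` and `yᵢ` could total more than `3` only if `i = a = b`. The tail
therefore lowers the weight by at most `3`, against `4` for the leading term when `c` differs from
`a` and `b`. -/
theorem lapXY_tail_mem (hab : a ≠ b)
    (hF : F ∈ Filt (leadWeight a b c) p k w) :
    (∑ i ∈ Finset.univ.erase c, pd (Sum.inl i) * pd (Sum.inr i)) F ∈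
      Filt (leadWeight a b c) (p - 1) (k - 1) (w - 3) :=
  sum_pd_pd_mem_filt _ _ _ (fun i _ => by simp [wy]) (fun i _ => by simp [wx])
    (fun i hi => by
      have h := Finset.ne_of_mem_erase hi
      simp only [leadWeight, Sum.elim_inl, Sum.elim_inr, h, if_false]
      split_ifs with h1 h2 <;> first | linarith | exact absurd (h1.symm.trans h2) hab) hF

theorem lapY_tail_mem (hF : F ∈ Filt (leadWeight a b c) p k w) :
    (∑ i ∈ Finset.univ.erase b, pd (Sum.inr i) * pd (Sum.inr i)) F ∈
      Filt (leadWeight a b c) (p - 2) k (w - 4) :=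
  sum_pd_pd_mem_filt _ _ _ (fun i _ => by simp [wy]; ring) (fun i _ => by simp [wx])
    (fun i hi => by
      have := leadWeight_inr_le (a := a) (c := c) (Finset.ne_of_mem_erase hi)
      linarith) hF

theorem lapXY_mem (hac : a ≠ c) (hbc : b ≠ c) (hab : a ≠ b)
    (hF : F ∈ Filt (leadWeight a b c) p k w) :
    lapXY F ∈ Filt (leadWeight a b c) (p - 1) (k - 1) (w - 4) := by
  rw [lapXY_eq c, LinearMap.add_apply]
  refine Submodule.add_mem _ (pd_pd_mem_filt _ _ (by simp [wy]) (by simp [wx]) ?_ hF)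
    (filt_mono (by linarith) (lapXY_tail_mem hab hF))
  have := leadWeight_inl_le (a := a) (b := b) (c := c) hac.symm
  have := leadWeight_inr_le (a := a) (b := b) (c := c) hbc.symm
  linarith

theorem lapY_mem (hF : F ∈ Filt (leadWeight a b c) p k w) :
    lapY F ∈ Filt (leadWeight a b c) (p - 2) k (w - 6) := by
  rw [lapY_eq b, LinearMap.add_apply]
  refine Submodule.add_mem _ (pd_pd_mem_filt _ _ (by simp [wy]; ring) (by simp [wx]) ?_ hF)
    (filt_mono (by linarith) (lapY_tail_mem hF))
  linarith [leadWeight_inr_self a b c]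

/-- The leading term `∂²/∂xₐ²` would cost `6` in weight. It commutes with integration in `s` and
`t`, and on `F` it equals minus the tail because `lapX F = 0`; hence only `4` is lost. -/
theorem lapX_integ_integ_mem {s t : ι ⊕ ι} (hs : Sum.inl a ≠ s) (ht : Sum.inl a ≠ t)
    {p' k' w' : ℤ} (hp : p' = p + wy s + wy t) (hk : k' = k - 2 + wx s + wx t)
    (hw : w' ≤ w - 4 + leadWeight a b c s + leadWeight a b c t)
    (hF : F ∈ Filt (leadWeight a b c) p k w) (hF0 : lapX F = 0) :
    lapX ((integ s * integ t) F) ∈ Filt (leadWeight a b c) p' k' w' := by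
  rw [lapX_eq a, LinearMap.add_apply] at hF0 ⊢
  rw [pd_pd_integ_integ_comm hs ht hs ht, eq_neg_of_add_eq_zero_left hF0, map_neg]
  refine Submodule.add_mem _ (Submodule.neg_mem _
    (integ_integ_mem_filt s t hp hk hw (lapX_tail_mem hF))) ?_
  have h1 := lapX_tail_mem (integ_integ_mem_filt s t rfl rfl le_rfl hF)
  rw [hp, hk, show k - 2 + wx s + wx t = k + wx s + wx t - 2 by ring]
  exact filt_mono (by linarith) h1

theorem exists_lapX_eq (a b c : ι) (hF : F ∈ Filt (leadWeight a b c) p k w) :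
    ∃ u ∈ Filt (leadWeight a b c) p (k + 2) (w + 6), lapX u = F := by
  obtain ⟨u, hu, hu'⟩ := exists_solution_of_approx lapX (Filt (leadWeight a b c) p k)
    (fun w => Filt (leadWeight a b c) p (k + 2) (w + 6)) ⊤ ⊤ (3 * (p + k))
    (fun w hw => filt_leadWeight_eq_bot a b c w hw) (fun w w' h => filt_mono (by linarith))
    (fun w f hf => by
      -- Two integrations in `xₐ` gain `6` and the tail loses at most `4`, so the error sits at
      -- level `w + 2`.
      have hu : (integ (Sum.inl a) * integ (Sum.inl a)) f ∈
          Filt (leadWeight a b c) p (k + 2) (w + 6) :=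
        integ_integ_mem_filt _ _ (by simp [wy]) (by simp [wx]; ring)
          (by linarith [leadWeight_inl_self a b c]) hf.1
      refine ⟨_, ⟨hu, trivial⟩, ?_, trivial⟩
      rw [lapX_eq a, LinearMap.add_apply, pd_pd_integ_integ, sub_add_cancel_left]
      refine Submodule.neg_mem _ ?_
      have := lapX_tail_mem hu
      rw [add_sub_cancel_right] at this
      exact filt_mono (by linarith) this) w F ⟨hF, trivial⟩
  exact ⟨u, hu.1, hu'⟩

/-- Integrating in `x_c` and `y_c` solves the leading equation but spoils harmonicity in `x`; a
solution `v` of `lapX v = lapX u` repairs it, with weight high enough not to disturb the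
approximation. -/
theorem exists_lapXY_eq (hac : a ≠ c) (hbc : b ≠ c) (hab : a ≠ b)
    (hF : F ∈ Filt (leadWeight a b c) p k w) (hF0 : lapX F = 0) :
    ∃ u ∈ Filt (leadWeight a b c) (p + 1) (k + 1) (w + 4), lapX u = 0 ∧ lapXY u = F := by
  obtain ⟨u, hu, hu'⟩ := exists_solution_of_approx lapXY (Filt (leadWeight a b c) p k)
    (fun w => Filt (leadWeight a b c) (p + 1) (k + 1) (w + 4))
    (LinearMap.ker lapX) (LinearMap.ker lapX) (3 * (p + k))
    (fun w hw => filt_leadWeight_eq_bot a b c w hw) (fun w w' h => filt_mono (by linarith))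
    (fun w f hf => by
      have hl : leadWeight a b c (Sum.inl c) = 2 := by simp [leadWeight, hac.symm]
      have hr : leadWeight a b c (Sum.inr c) = 2 := by simp [leadWeight, hbc.symm]
      have hf0 : lapX f = 0 := hf.2
      set u := (integ (Sum.inr c) * integ (Sum.inl c)) f with hudef
      have hu : u ∈ Filt (leadWeight a b c) (p + 1) (k + 1) (w + 4) :=
        integ_integ_mem_filt _ _ (by simp [wy]) (by simp [wx]) (by linarith) hf.1
      have hAu : lapX u ∈ Filt (leadWeight a b c) (p + 1) (k - 1) w :=
        lapX_integ_integ_mem (by simp) (by simpa using hac) (by simp [wy])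
          (by simp [wx]; ring) (by linarith) hf.1 hf0
      -- `v` lies at level `w + 6`, so `lapXY v` is at level `w + 2`; the tail applied to `u` is at
      -- level `w + 1`.
      obtain ⟨v, hv, hv'⟩ := exists_lapX_eq a b c hAu
      rw [show k - 1 + 2 = k + 1 by ring] at hv
      refine ⟨u - v, ⟨Submodule.sub_mem _ hu (filt_mono (by linarith) hv), ?_⟩, ?_, ?_⟩
      · simp [hv']
      · have e : f - lapXY (u - v) = lapXY v -
            (∑ i ∈ Finset.univ.erase c, pd (Sum.inl i) * pd (Sum.inr i)) u := by
          rw [map_sub, lapXY_eq c, LinearMap.add_apply _ _ u, hudef, pd_pd_integ_integ]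
          abel
        rw [e]
        have h1 := lapXY_mem hac hbc hab hv
        have h2 := lapXY_tail_mem hab hu
        rw [add_sub_cancel_right, add_sub_cancel_right] at h1 h2
        exact Submodule.sub_mem _ (filt_mono (by linarith) h1) (filt_mono (by linarith) h2)
      · rw [SetLike.mem_coe, LinearMap.mem_ker, map_sub, hf0, lapX_lapXY, map_sub, hv', sub_self,
          map_zero, sub_zero]) w F ⟨hF, hF0⟩
  exact ⟨u, hu.1, hu.2, hu'⟩

/-- Integrating twice in `y_b` breaks both side conditions. They are restored in order: `v₁` cancels
`lapX u`, then `v₂`, itself harmonic in `x`, cancels what remains of `lapXY u`. -/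
theorem exists_lapY_eq (hac : a ≠ c) (hbc : b ≠ c) (hab : a ≠ b)
    (hF : F ∈ Filt (leadWeight a b c) p k w) (hF0 : lapX F = 0) (hF1 : lapXY F = 0) :
    ∃ u ∈ Filt (leadWeight a b c) (p + 2) k w, lapX u = 0 ∧ lapXY u = 0 ∧ lapY u = F := by
  obtain ⟨u, hu, hu'⟩ := exists_solution_of_approx lapY (Filt (leadWeight a b c) p k)
    (fun w => Filt (leadWeight a b c) (p + 2) k w)
    (LinearMap.ker lapX ⊓ LinearMap.ker lapXY) (LinearMap.ker lapX ⊓ LinearMap.ker lapXY)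
    (3 * (p + k))
    (fun w hw => filt_leadWeight_eq_bot a b c w hw) (fun w w' h => filt_mono h)
    (fun w f hf => by
      have hr : leadWeight a b c (Sum.inr b) = 3 := by simp [leadWeight]
      have hf0 : lapX f = 0 := hf.2.1
      have hf1 : lapXY f = 0 := hf.2.2
      set u := (integ (Sum.inr b) * integ (Sum.inr b)) f with hudef
      have hu : u ∈ Filt (leadWeight a b c) (p + 2) k (w + 6) :=
        integ_integ_mem_filt _ _ (by simp [wy]; ring) (by simp [wx]) (by linarith) hf.1
      have hAu : lapX u ∈ Filt (leadWeight a b c) (p + 2) (k - 2) (w + 2) :=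
        lapX_integ_integ_mem (by simp) (by simp) (by simp [wy]; ring)
          (by simp [wx]) (by linarith) hf.1 hf0
      have hBu : lapXY u ∈ Filt (leadWeight a b c) (p + 1) (k - 1) (w + 3) := by
        have h2 := lapXY_tail_mem hab hu
        have h3 := lapXY_tail_mem hab hf.1
        rw [lapXY_eq c, LinearMap.add_apply] at hf1 ⊢
        rw [hudef, pd_pd_integ_integ_comm (by simp) (by simp) (by simpa using hbc.symm)
          (by simpa using hbc.symm), eq_neg_of_add_eq_zero_left hf1, map_neg, ← hudef]
        refine Submodule.add_mem _ (Submodule.neg_mem _ ?_) ?_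
        · exact integ_integ_mem_filt _ _ (by simp [wy]) (by simp [wx]) (by linarith) h3
        · rw [show p + 2 - 1 = p + 1 by ring] at h2
          exact filt_mono (by linarith) h2
      obtain ⟨v₁, hv₁, hv₁'⟩ := exists_lapX_eq a b c hAu
      rw [sub_add_cancel] at hv₁
      have hBv := lapXY_mem hac hbc hab hv₁
      rw [show p + 2 - 1 = p + 1 by ring] at hBv
      obtain ⟨v₂, hv₂, hAv₂, hBv₂⟩ := exists_lapXY_eq hac hbc hab (F := lapXY u - lapXY v₁)
        (Submodule.sub_mem _ hBu (filt_mono (by linarith) hBv)) (by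
          rw [map_sub, lapX_lapXY, lapX_lapXY, hv₁', sub_self])
      rw [sub_add_cancel, show p + 1 + 1 = p + 2 by ring] at hv₂
      -- `v₁` is at level `w + 8` and `v₂` at `w + 7`; as `lapY` loses at most `6`, the correction
      -- contributes at level `w + 1`, exactly what the approximation requires.
      have hv : v₁ + v₂ ∈ Filt (leadWeight a b c) (p + 2) k (w + 7) :=
        Submodule.add_mem _ (filt_mono (by linarith) hv₁) (filt_mono (by linarith) hv₂)
      have hA : lapX (u - (v₁ + v₂)) = 0 := by simp [hv₁', hAv₂]
      have hB : lapXY (u - (v₁ + v₂)) = 0 := by simp [hBv₂]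
      refine ⟨u - (v₁ + v₂), ⟨Submodule.sub_mem _ (filt_mono (by linarith) hu)
        (filt_mono (by linarith) hv), hA, hB⟩, ?_, ?_, ?_⟩
      · have e : f - lapY (u - (v₁ + v₂)) = lapY (v₁ + v₂) -
            (∑ i ∈ Finset.univ.erase b, pd (Sum.inr i) * pd (Sum.inr i)) u := by
          rw [map_sub, lapY_eq b, LinearMap.add_apply _ _ u, hudef, pd_pd_integ_integ]
          abel
        rw [e]
        have h1 := lapY_mem hv
        have h2 := lapY_tail_mem hu
        rw [add_sub_cancel_right] at h1 h2
        exact Submodule.sub_mem _ (filt_mono (by linarith) h1) (filt_mono (by linarith) h2)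
      · rw [SetLike.mem_coe, LinearMap.mem_ker, map_sub, hf0, lapX_lapY, hA, map_zero, sub_zero]
      · rw [SetLike.mem_coe, LinearMap.mem_ker, map_sub, hf1, lapXY_lapY, hB, map_zero, sub_zero])
    w F ⟨hF, hF0, hF1⟩
  exact ⟨u, hu.1, hu.2.1, hu.2.2, hu'⟩

end Surjectivity

/-! ### Surjectivity in positive weight for `𝔰𝔩₂`. -/

section SlTwo

variable {M : Type*} [AddCommGroup M] [Module ℝ M] {e f h : Module.End ℝ M}

theorem pow_succ_lower_of_weight (hef : e * f = f * e + h) (hhe : h * e = e * h + (2 : ℝ) • e)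
    (j : ℕ) : ∀ (c : ℝ) (v : M), h v = c • v →
      (e ^ (j + 1)) (f v) = f ((e ^ (j + 1)) v) + ((j + 1) * (c + j)) • (e ^ j) v := by
  have hef' : ∀ v, e (f v) = f (e v) + h v := LinearMap.congr_fun hef
  have hhe' : ∀ v, h (e v) = e (h v) + (2 : ℝ) • e v := LinearMap.congr_fun hhe
  induction j with
  | zero =>
    intro c v hv
    simp [hef', hv]
  | succ j ih =>
    intro c v hv
    have h1 : h (e v) = (c + 2) • e v := by rw [hhe', hv, map_smul, add_smul]
    rw [pow_succ e (j + 1), Module.End.mul_apply, hef', map_add, ih _ _ h1, hv, map_smul,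
      Module.End.mul_apply, show (e ^ j) (e v) = (e ^ (j + 1)) v by rw [pow_succ]; rfl, add_assoc, ← add_smul]
    congr 2
    push_cast
    ring

/-- In a finite-dimensional representation of `𝔰𝔩₂`, the vectors of positive weight are in the image
of `e * f`. -/
theorem exists_raise_lower_eq (hef : e * f = f * e + h) (hhe : h * e = e * h + (2 : ℝ) • e)
    {c : ℝ} (hc : 0 < c) {K : Submodule ℝ M} (hK : ∀ v ∈ K, h v = c • v)
    (hKef : ∀ v ∈ K, e (f v) ∈ K) (j : ℕ) : ∀ v ∈ K, (e ^ j) v = 0 → ∃ z ∈ K, e (f z) = v := by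
  induction j with
  | zero => exact fun v _ hv => ⟨0, K.zero_mem, by simpa using hv.symm⟩
  | succ j ih =>
    intro v hvK hv
    -- If `e ^ (j + 1)` kills `v`, the commutation formula gives `e ^ j (e (f v)) = d • e ^ j v`.
    -- Since `c > 0` makes `d` nonzero, `v - d⁻¹ • e (f v)` is killed by `e ^ j` and the induction
    -- applies to it.
    set d : ℝ := (j + 1) * (c + j)
    have hd : d ≠ 0 := by positivity
    have h0 : (e ^ j) (e (f v)) = d • (e ^ j) v := by
      rw [← Module.End.mul_apply, ← pow_succ, pow_succ_lower_of_weight hef hhe j c v (hK v hvK),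
        hv, map_zero, zero_add]
    obtain ⟨z, hz, hz'⟩ := ih (v - d⁻¹ • e (f v))
      (K.sub_mem hvK (K.smul_mem _ (hKef v hvK)))
      (by rw [map_sub, map_smul, h0, smul_smul, inv_mul_cancel₀ hd, one_smul, sub_self])
    exact ⟨z + d⁻¹ • v, K.add_mem hz (K.smul_mem _ hvK), by simp [hz']⟩

end SlTwo

/-! ### The `𝔰𝔩₂` action on bihomogeneous polynomials and on the joint kernels. -/

section RaiseLower

variable (ι : Type*)

/-- The derivation `∑ yᵢ ∂/∂xᵢ`. -/
def raiseD : Derivation ℝ (BiPoly ι) (BiPoly ι) :=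
  mkDerivation ℝ (Sum.elim (fun i => X (Sum.inr i)) 0)

/-- The derivation `∑ xᵢ ∂/∂yᵢ`. -/
def lowerD : Derivation ℝ (BiPoly ι) (BiPoly ι) :=
  mkDerivation ℝ (Sum.elim 0 (fun i => X (Sum.inl i)))

/-- The derivation `∑ yᵢ ∂/∂yᵢ - ∑ xᵢ ∂/∂xᵢ`. -/
def weightD : Derivation ℝ (BiPoly ι) (BiPoly ι) :=
  mkDerivation ℝ (Sum.elim (fun i => -X (Sum.inl i)) (fun i => X (Sum.inr i)))

/-- The operator `∑ yᵢ ∂/∂xᵢ`. -/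
def raise : Module.End ℝ (BiPoly ι) := (raiseD ι).toLinearMap

/-- The operator `∑ xᵢ ∂/∂yᵢ`. -/
def lower : Module.End ℝ (BiPoly ι) := (lowerD ι).toLinearMap

/-- The operator `∑ yᵢ ∂/∂yᵢ - ∑ xᵢ ∂/∂xᵢ`. -/
def weightOp : Module.End ℝ (BiPoly ι) := (weightD ι).toLinearMap

variable {ι}

/-- A commutator of derivations is a derivation, hence determined by its values on the variables. -/
theorem end_eq_of_commutator {D₁ D₂ D₃ : Derivation ℝ (BiPoly ι) (BiPoly ι)}
    (h : ∀ s, D₁ (D₂ (X s)) = D₂ (D₁ (X s)) + D₃ (X s)) :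
    D₁.toLinearMap * D₂.toLinearMap = D₂.toLinearMap * D₁.toLinearMap + D₃.toLinearMap := by
  have : ⁅D₁, D₂⁆ = D₃ := derivation_ext fun s => by
    rw [Derivation.commutator_apply, h s, add_sub_cancel_left]
  refine LinearMap.ext fun F => ?_
  have h1 := congrArg (fun D : Derivation ℝ (BiPoly ι) (BiPoly ι) => D F) this
  simp only [Derivation.commutator_apply] at h1
  simpa [sub_eq_iff_eq_add'] using h1

theorem raise_mul_lower : raise ι * lower ι = lower ι * raise ι + weightOp ι :=
  end_eq_of_commutator fun s => by cases s <;> simp [raiseD, lowerD, weightD, mkDerivation_X]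

theorem weightOp_mul_raise : weightOp ι * raise ι = raise ι * weightOp ι + (2 : ℝ) • raise ι :=
  end_eq_of_commutator (D₃ := (2 : ℝ) • raiseD ι) fun s => by
    cases s <;> simp [raiseD, weightD, mkDerivation_X, two_smul]

theorem weightOp_mul_lower :
    weightOp ι * lower ι = lower ι * weightOp ι + (-2 : ℝ) • lower ι :=
  end_eq_of_commutator (D₃ := (-2 : ℝ) • lowerD ι) fun s => by
    cases s <;> simp [lowerD, weightD, mkDerivation_X, two_smul]

theorem pd_inl_raise (i : ι) : pd (Sum.inl i) * raise ι = raise ι * pd (Sum.inl i) :=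
  (end_eq_of_commutator (D₃ := 0) fun s => by
    classical cases s <;> simp [raiseD, mkDerivation_X, Pi.single_apply, apply_ite]).trans (add_zero _)

theorem pd_inr_raise (i : ι) :
    pd (Sum.inr i) * raise ι = raise ι * pd (Sum.inr i) + pd (Sum.inl i) :=
  end_eq_of_commutator fun s => by
    classical cases s <;> simp [raiseD, mkDerivation_X, Pi.single_apply, apply_ite]

theorem pd_inr_lower (i : ι) : pd (Sum.inr i) * lower ι = lower ι * pd (Sum.inr i) :=
  (end_eq_of_commutator (D₃ := 0) fun s => by
    classical cases s <;> simp [lowerD, mkDerivation_X, Pi.single_apply, apply_ite]).trans (add_zero _)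

theorem pd_inl_lower (i : ι) :
    pd (Sum.inl i) * lower ι = lower ι * pd (Sum.inl i) + pd (Sum.inr i) :=
  end_eq_of_commutator fun s => by
    classical cases s <;> simp [lowerD, mkDerivation_X, Pi.single_apply, apply_ite]

variable [Fintype ι]

theorem derivation_sum_apply (D : ι → Derivation ℝ (BiPoly ι) (BiPoly ι)) (F : BiPoly ι) :
    (∑ i, D i) F = ∑ i, D i F := by
  change Derivation.coeFnAddMonoidHom (R := ℝ) (A := BiPoly ι) (M := BiPoly ι) (∑ i, D i) F = _
  rw [map_sum, Finset.sum_apply]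
  rfl

theorem raise_eq_sum : raise ι = ∑ i, mulX (Sum.inr i) * pd (Sum.inl i) := by
  have : raiseD ι = ∑ i, (X (Sum.inr i) : BiPoly ι) • pderiv (Sum.inl i) :=
    derivation_ext fun s => by
      simp only [derivation_sum_apply, Derivation.smul_apply]
      classical cases s <;> simp [raiseD, mkDerivation_X, Pi.single_apply]
  refine LinearMap.ext fun F => ?_
  have h1 := congrArg (fun D : Derivation ℝ (BiPoly ι) (BiPoly ι) => D F) this
  simpa [derivation_sum_apply, raise, pd_apply, mulX_apply] using h1

theorem lower_eq_sum : lower ι = ∑ i, mulX (Sum.inl i) * pd (Sum.inr i) := by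
  have : lowerD ι = ∑ i, (X (Sum.inl i) : BiPoly ι) • pderiv (Sum.inr i) :=
    derivation_ext fun s => by
      simp only [derivation_sum_apply, Derivation.smul_apply]
      classical cases s <;> simp [lowerD, mkDerivation_X, Pi.single_apply]
  refine LinearMap.ext fun F => ?_
  have h1 := congrArg (fun D : Derivation ℝ (BiPoly ι) (BiPoly ι) => D F) this
  simpa [derivation_sum_apply, lower, pd_apply, mulX_apply] using h1

/-- This and the next five identities say that the span of `lapX`, `lapXY`, `lapY` is stable under
commutators with `raise` and `lower`; hence both preserve the joint kernel `Harm`. -/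
theorem lapX_raise : lapX * raise ι = raise ι * lapX := by
  simp only [lapX, Finset.sum_mul, Finset.mul_sum]
  refine Finset.sum_congr rfl fun i _ => ?_
  rw [mul_assoc, pd_inl_raise, ← mul_assoc, pd_inl_raise, mul_assoc]

theorem lapXY_raise : lapXY * raise ι = raise ι * lapXY + lapX := by
  simp only [lapX, lapXY, Finset.sum_mul, Finset.mul_sum, ← Finset.sum_add_distrib]
  refine Finset.sum_congr rfl fun i _ => ?_
  rw [mul_assoc, pd_inr_raise, mul_add, ← mul_assoc, pd_inl_raise, mul_assoc]

theorem lapY_raise : lapY * raise ι = raise ι * lapY + (2 : ℝ) • lapXY := by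
  simp only [lapY, lapXY, Finset.sum_mul, Finset.mul_sum, Finset.smul_sum,
    ← Finset.sum_add_distrib]
  refine Finset.sum_congr rfl fun i _ => ?_
  rw [mul_assoc, pd_inr_raise, mul_add, ← mul_assoc, pd_inr_raise, add_mul, mul_assoc,
    pd_comm (Sum.inr i) (Sum.inl i), two_smul, add_assoc]

theorem lapY_lower : lapY * lower ι = lower ι * lapY := by
  simp only [lapY, Finset.sum_mul, Finset.mul_sum]
  refine Finset.sum_congr rfl fun i _ => ?_
  rw [mul_assoc, pd_inr_lower, ← mul_assoc, pd_inr_lower, mul_assoc]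

theorem lapXY_lower : lapXY * lower ι = lower ι * lapXY + lapY := by
  simp only [lapY, lapXY, Finset.sum_mul, Finset.mul_sum, ← Finset.sum_add_distrib]
  refine Finset.sum_congr rfl fun i _ => ?_
  rw [mul_assoc, pd_inr_lower, ← mul_assoc, pd_inl_lower, add_mul, mul_assoc]

theorem lapX_lower : lapX * lower ι = lower ι * lapX + (2 : ℝ) • lapXY := by
  simp only [lapX, lapXY, Finset.sum_mul, Finset.mul_sum, Finset.smul_sum,
    ← Finset.sum_add_distrib]
  refine Finset.sum_congr rfl fun i _ => ?_
  rw [mul_assoc, pd_inl_lower, mul_add, ← mul_assoc, pd_inl_lower, add_mul, mul_assoc,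
    pd_comm (Sum.inr i) (Sum.inl i), two_smul, add_assoc]

variable {p k : ℤ} {F : BiPoly ι}

theorem lapX_mem_bihom (hF : F ∈ Bihom ι p k) : lapX F ∈ Bihom ι p (k - 2) :=
  sum_pd_pd_mem_filt _ _ _ (by simp [wy]) (by simp [wx, sub_sub]) (by simp) hF

theorem lapXY_mem_bihom (hF : F ∈ Bihom ι p k) : lapXY F ∈ Bihom ι (p - 1) (k - 1) :=
  sum_pd_pd_mem_filt _ _ _ (by simp [wy]) (by simp [wx]) (by simp) hF

theorem lapY_mem_bihom (hF : F ∈ Bihom ι p k) : lapY F ∈ Bihom ι (p - 2) k :=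
  sum_pd_pd_mem_filt _ _ _ (by simp [wy, sub_sub]) (by simp [wx]) (by simp) hF

theorem raise_mem_bihom (hF : F ∈ Bihom ι p k) : raise ι F ∈ Bihom ι (p + 1) (k - 1) := by
  rw [raise_eq_sum, LinearMap.sum_apply]
  exact Submodule.sum_mem _ fun i _ => mulX_mem_bihom (p := p) (k := k - 1) _ (by simp [wy])
    (by simp [wx]) (pd_mem_bihom _ (by simp [wy]) (by simp [wx]) hF)

theorem lower_mem_bihom (hF : F ∈ Bihom ι p k) : lower ι F ∈ Bihom ι (p - 1) (k + 1) := by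
  rw [lower_eq_sum, LinearMap.sum_apply]
  exact Submodule.sum_mem _ fun i _ => mulX_mem_bihom (p := p - 1) (k := k) _ (by simp [wy])
    (by simp [wx]) (pd_mem_bihom _ (by simp [wy]) (by simp [wx]) hF)

/-- Euler's identity in the variables `y`. -/
theorem sum_mulX_pd_inr (hF : F ∈ Bihom ι p k) :
    ∑ i, mulX (Sum.inr i) (pd (Sum.inr i) F) = (p : ℝ) • F := by
  have : (∑ i, mulX (Sum.inr i) * pd (Sum.inr i) - (p : ℝ) • 1 : Module.End ℝ (BiPoly ι)) F ∈
      (⊥ : Submodule ℝ (BiPoly ι)) := map_mem_filt (fun m h1 _ _ => by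
    rw [Finsupp.weight_eq_sum, Fintype.sum_sum_type] at h1
    simp only [wy, Sum.elim_inl, Sum.elim_inr] at h1
    rw [Submodule.mem_bot, LinearMap.sub_apply, sub_eq_zero, LinearMap.sum_apply, ← h1]
    simp only [Module.End.mul_apply, mulX_apply, pd_apply, X_mul_pderiv_monomial]
    rw [← Finset.sum_smul]
    simp [← Nat.cast_smul_eq_nsmul ℝ, Finset.sum_smul]) hF
  simpa [sub_eq_zero] using this

theorem sum_mulX_pd_inl (hF : F ∈ Bihom ι p k) :
    ∑ i, mulX (Sum.inl i) (pd (Sum.inl i) F) = (k : ℝ) • F := by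
  have : (∑ i, mulX (Sum.inl i) * pd (Sum.inl i) - (k : ℝ) • 1 : Module.End ℝ (BiPoly ι)) F ∈
      (⊥ : Submodule ℝ (BiPoly ι)) := map_mem_filt (fun m _ h1 _ => by
    rw [Finsupp.weight_eq_sum, Fintype.sum_sum_type] at h1
    simp only [wx, Sum.elim_inl, Sum.elim_inr] at h1
    rw [Submodule.mem_bot, LinearMap.sub_apply, sub_eq_zero, LinearMap.sum_apply, ← h1]
    simp only [Module.End.mul_apply, mulX_apply, pd_apply, X_mul_pderiv_monomial]
    rw [← Finset.sum_smul]
    simp [← Nat.cast_smul_eq_nsmul ℝ, Finset.sum_smul]) hF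
  simpa [sub_eq_zero] using this

theorem weightOp_eq_sum : weightOp ι = ∑ i, mulX (Sum.inr i) * pd (Sum.inr i) -
    ∑ i, mulX (Sum.inl i) * pd (Sum.inl i) := by
  have : weightD ι = ∑ i, (X (Sum.inr i) : BiPoly ι) • pderiv (Sum.inr i) -
      ∑ i, (X (Sum.inl i) : BiPoly ι) • pderiv (Sum.inl i) :=
    derivation_ext fun s => by
      simp only [Derivation.sub_apply, derivation_sum_apply, Derivation.smul_apply]
      classical cases s <;> simp [weightD, mkDerivation_X, Pi.single_apply]
  refine LinearMap.ext fun F => ?_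
  have h1 := congrArg (fun D : Derivation ℝ (BiPoly ι) (BiPoly ι) => D F) this
  simpa [derivation_sum_apply, weightOp, pd_apply, mulX_apply] using h1

theorem weightOp_apply (hF : F ∈ Bihom ι p k) : weightOp ι F = ((p : ℝ) - k) • F := by
  have h1 := sum_mulX_pd_inr hF
  have h2 := sum_mulX_pd_inl hF
  rw [weightOp_eq_sum, LinearMap.sub_apply, LinearMap.sum_apply, LinearMap.sum_apply]
  simp only [Module.End.mul_apply]
  rw [h1, h2, sub_smul]

variable (ι p k)

/-- Bihomogeneous polynomials harmonic in `x`. -/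
def HarmX : Submodule ℝ (BiPoly ι) := Bihom ι p k ⊓ LinearMap.ker lapX

/-- Bihomogeneous polynomials killed by the Laplacian in `x` and the mixed operator. -/
def HarmXY : Submodule ℝ (BiPoly ι) := HarmX ι p k ⊓ LinearMap.ker lapXY

/-- Bihomogeneous polynomials killed by both Laplacians and the mixed operator. -/
def Harm : Submodule ℝ (BiPoly ι) := HarmXY ι p k ⊓ LinearMap.ker lapY

variable {ι p k}

theorem mem_harm : F ∈ Harm ι p k ↔ F ∈ Bihom ι p k ∧ lapX F = 0 ∧ lapXY F = 0 ∧ lapY F = 0 := by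
  simp only [Harm, HarmXY, HarmX, Submodule.mem_inf, LinearMap.mem_ker, and_assoc]

theorem raise_mem_harm (hF : F ∈ Harm ι p k) : raise ι F ∈ Harm ι (p + 1) (k - 1) := by
  obtain ⟨h0, h1, h2, h3⟩ := mem_harm.1 hF
  refine mem_harm.2 ⟨raise_mem_bihom h0, ?_, ?_, ?_⟩
  · have := LinearMap.congr_fun lapX_raise F
    simpa [h1] using this
  · have := LinearMap.congr_fun lapXY_raise F
    simpa [h1, h2] using this
  · have := LinearMap.congr_fun lapY_raise F
    simpa [h3, h2] using this

theorem lower_mem_harm (hF : F ∈ Harm ι p k) : lower ι F ∈ Harm ι (p - 1) (k + 1) := by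
  obtain ⟨h0, h1, h2, h3⟩ := mem_harm.1 hF
  refine mem_harm.2 ⟨lower_mem_bihom h0, ?_, ?_, ?_⟩
  · have := LinearMap.congr_fun lapX_lower F
    simpa [h1, h2] using this
  · have := LinearMap.congr_fun lapXY_lower F
    simpa [h3, h2] using this
  · have := LinearMap.congr_fun lapY_lower F
    simpa [h3] using this

theorem harm_le_bihom : Harm ι p k ≤ Bihom ι p k := fun _ h => (mem_harm.1 h).1

theorem raise_pow_mem (j : ℕ) (hF : F ∈ Harm ι p k) :
    (raise ι ^ j) F ∈ Harm ι (p + j) (k - j) := by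
  induction j with
  | zero => simpa using hF
  | succ j ih =>
    rw [pow_succ', Module.End.mul_apply]
    have := raise_mem_harm ih
    push_cast
    rwa [← add_assoc, ← sub_sub]

theorem lower_pow_mem (j : ℕ) (hF : F ∈ Harm ι p k) :
    (lower ι ^ j) F ∈ Harm ι (p - j) (k + j) := by
  induction j with
  | zero => simpa using hF
  | succ j ih =>
    rw [pow_succ', Module.End.mul_apply]
    have := lower_mem_harm ih
    push_cast
    rwa [← add_assoc, ← sub_sub]

/-- Each application lowers the `x`-degree by one, and `k + 1` of them make it negative; if `k` is
already negative, `toNat` gives `0` and `F` itself vanishes. -/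
theorem raise_pow_eq_zero (hF : F ∈ Harm ι p k) : (raise ι ^ (k + 1).toNat) F = 0 := by
  have h := harm_le_bihom (raise_pow_mem (k + 1).toNat hF)
  rwa [bihom_eq_bot_right (by omega), Submodule.mem_bot] at h

theorem lower_pow_eq_zero (hF : F ∈ Harm ι p k) : (lower ι ^ (p + 1).toNat) F = 0 := by
  have h := harm_le_bihom (lower_pow_mem (p + 1).toNat hF)
  rwa [bihom_eq_bot_left (by omega), Submodule.mem_bot] at h

/-- The target has weight `p - k + 2`, which is positive exactly when `k ≤ p + 1`. -/
theorem exists_raise_eq (hkp : k ≤ p + 1) (hF : F ∈ Harm ι (p + 1) (k - 1)) :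
    ∃ u ∈ Harm ι p k, raise ι u = F := by
  have hc : (0 : ℝ) < ((p + 1 : ℤ) : ℝ) - ((k - 1 : ℤ) : ℝ) := by
    rw [sub_pos]; exact_mod_cast (by linarith : k - 1 < p + 1)
  have hlow : ∀ v ∈ Harm ι (p + 1) (k - 1), lower ι v ∈ Harm ι p k := fun v hv => by
    have := lower_mem_harm hv
    rwa [add_sub_cancel_right, sub_add_cancel] at this
  obtain ⟨z, hz, hz'⟩ := exists_raise_lower_eq raise_mul_lower weightOp_mul_raise hc
    (K := Harm ι (p + 1) (k - 1)) (fun v hv => weightOp_apply (harm_le_bihom hv))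
    (fun v hv => raise_mem_harm (hlow v hv)) _ F hF (raise_pow_eq_zero hF)
  exact ⟨lower ι z, hlow z hz, hz'⟩

theorem exists_lower_eq (hkp : p ≤ k + 1) (hF : F ∈ Harm ι (p - 1) (k + 1)) :
    ∃ u ∈ Harm ι p k, lower ι u = F := by
  have hc : (0 : ℝ) < -(((p - 1 : ℤ) : ℝ) - ((k + 1 : ℤ) : ℝ)) := by
    rw [neg_pos, sub_neg]; exact_mod_cast (by linarith : p - 1 < k + 1)
  have hrai : ∀ v ∈ Harm ι (p - 1) (k + 1), raise ι v ∈ Harm ι p k := fun v hv => by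
    have := raise_mem_harm hv
    rwa [add_sub_cancel_right, sub_add_cancel] at this
  -- Exchanging the two operators and negating the weight gives another `𝔰𝔩₂` triple, for which the
  -- target has weight `k - p + 2`.
  obtain ⟨z, hz, hz'⟩ := exists_raise_lower_eq (e := lower ι) (f := raise ι) (h := -weightOp ι)
    (by rw [raise_mul_lower]; abel)
    (LinearMap.ext fun v => by
      have := LinearMap.congr_fun (weightOp_mul_lower (ι := ι)) v
      simp only [Module.End.mul_apply, LinearMap.add_apply, LinearMap.smul_apply] at this
      simp [this, add_comm]) hc
    (K := Harm ι (p - 1) (k + 1))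
    (fun v hv => by rw [LinearMap.neg_apply, weightOp_apply (harm_le_bihom hv), neg_smul])
    (fun v hv => lower_mem_harm (hrai v hv)) _ F hF (lower_pow_eq_zero hF)
  exact ⟨raise ι z, hrai z hz, hz'⟩

end RaiseLower

/-! ### Rank-nullity for a map between submodules. -/

section RankNullity

theorem finrank_inf_ker_add {M N : Type*} [AddCommGroup M] [Module ℝ M] [AddCommGroup N] [Module ℝ N]
    (T : M →ₗ[ℝ] N) (U : Submodule ℝ M) (W : Submodule ℝ N) [Module.Finite ℝ U]
    (hUW : ∀ u ∈ U, T u ∈ W) (hW : ∀ w ∈ W, ∃ u ∈ U, T u = w) :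
    Module.finrank ℝ (U ⊓ LinearMap.ker T : Submodule ℝ M) + Module.finrank ℝ W =
      Module.finrank ℝ U := by
  have h1 := LinearMap.finrank_range_add_finrank_ker (T.domRestrict U)
  have h2 : LinearMap.range (T.domRestrict U) = W := by
    ext w
    constructor
    · rintro ⟨u, rfl⟩; exact hUW _ u.2
    · intro hw
      obtain ⟨u, hu, rfl⟩ := hW w hw
      exact ⟨⟨u, hu⟩, rfl⟩
  have h3 : (LinearMap.ker (T.domRestrict U)).map U.subtype = U ⊓ LinearMap.ker T := by
    ext v
    simp only [Submodule.mem_map, LinearMap.mem_ker, Submodule.mem_inf]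
    constructor
    · rintro ⟨u, hu, rfl⟩; exact ⟨u.2, hu⟩
    · rintro ⟨hv, hv'⟩; exact ⟨⟨v, hv⟩, hv', rfl⟩
  rw [← h3, ← (Submodule.equivMapOfInjective U.subtype Subtype.val_injective _).finrank_eq, ← h2]
  omega

end RankNullity

/-! ### Finite-dimensionality and dimension of the bihomogeneous spaces. -/

section BihomFinrank

variable {ι : Type*} [Fintype ι]

/-- A pair of exponents of given degrees is an exponent in the double set of variables. -/
def exponentEquiv [DecidableEq ι] (p k : ℕ) :
    {m : ι ⊕ ι →₀ ℕ | Finsupp.weight wy m = (p : ℤ) ∧ Finsupp.weight wx m = (k : ℤ) ∧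
      (0 : ℤ) ≤ Finsupp.weight (0 : ι ⊕ ι → ℤ) m} ≃
    Finset.finsuppAntidiag (Finset.univ : Finset ι) k ×
      Finset.finsuppAntidiag (Finset.univ : Finset ι) p :=
  (Finsupp.sumFinsuppEquivProdFinsupp.subtypeEquiv fun m => by
    simp only [Set.mem_ofPred_eq, Finsupp.weight_eq_sum, Fintype.sum_sum_type, wx, wy,
      Sum.elim_inl, Sum.elim_inr, Finset.mem_finsuppAntidiag, Finset.subset_univ, and_true,
      Finsupp.fst_sumFinsuppEquivProdFinsupp, Finsupp.snd_sumFinsuppEquivProdFinsupp]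
    simp only [Pi.zero_apply, Pi.one_apply, smul_zero, Finset.sum_const_zero, zero_add, add_zero,
      le_refl, and_true, nsmul_eq_mul, mul_one, ← Nat.cast_sum, Nat.cast_inj]
    exact and_comm).trans
  (Equiv.subtypeProdEquivProd (p := fun f => f ∈ Finset.finsuppAntidiag Finset.univ k)
    (q := fun f => f ∈ Finset.finsuppAntidiag Finset.univ p))

instance finite_bihom (p k : ℤ) : Module.Finite ℝ (Bihom ι p k) := by
  classical
  rcases lt_or_ge p 0 with hp | hp
  · rw [bihom_eq_bot_left hp]; infer_instance
  rcases lt_or_ge k 0 with hk | hk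
  · rw [bihom_eq_bot_right hk]; infer_instance
  lift p to ℕ using hp
  lift k to ℕ using hk
  have := Finite.of_equiv _ (exponentEquiv (ι := ι) p k).symm
  exact Module.Finite.of_basis (basisRestrictSupport ℝ _)

theorem finrank_bihom_natCast (p k : ℕ) : Module.finrank ℝ (Bihom ι p k) =
    (Fintype.card ι + k - 1).choose k * (Fintype.card ι + p - 1).choose p := by
  classical
  rw [Bihom, Filt, Module.finrank_eq_nat_card_basis (basisRestrictSupport ℝ _),
    Nat.card_congr (exponentEquiv p k), Nat.card_prod, Nat.card_eq_fintype_card,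
    Nat.card_eq_fintype_card, Fintype.card_coe, Fintype.card_coe,
    Finset.card_finsuppAntidiag_nat_eq_choose, Finset.card_finsuppAntidiag_nat_eq_choose]
  rfl

instance finite_harmX (p k : ℤ) : Module.Finite ℝ (HarmX ι p k) :=
  Submodule.finiteDimensional_of_le (inf_le_left : HarmX ι p k ≤ Bihom ι p k)

instance finite_harmXY (p k : ℤ) : Module.Finite ℝ (HarmXY ι p k) :=
  Submodule.finiteDimensional_of_le (inf_le_left : HarmXY ι p k ≤ HarmX ι p k)

instance finite_harm (p k : ℤ) : Module.Finite ℝ (Harm ι p k) :=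
  Submodule.finiteDimensional_of_le (inf_le_left : Harm ι p k ≤ HarmXY ι p k)

end BihomFinrank

/-! ### Dimension recursions from the surjectivity results. -/

section Dimensions

variable {ι : Type*} [Fintype ι]

theorem mem_harmX {p k : ℤ} {F : BiPoly ι} : F ∈ HarmX ι p k ↔ F ∈ Bihom ι p k ∧ lapX F = 0 :=
  Iff.rfl

theorem mem_harmXY {p k : ℤ} {F : BiPoly ι} :
    F ∈ HarmXY ι p k ↔ F ∈ Bihom ι p k ∧ lapX F = 0 ∧ lapXY F = 0 := by
  simp only [HarmXY, HarmX, Submodule.mem_inf, LinearMap.mem_ker, and_assoc]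

theorem finrank_harm_inf_ker_raise {p k : ℤ} (h : k ≤ p + 1) :
    Module.finrank ℝ (Harm ι p k ⊓ LinearMap.ker (raise ι) : Submodule ℝ (BiPoly ι)) +
      Module.finrank ℝ (Harm ι (p + 1) (k - 1)) = Module.finrank ℝ (Harm ι p k) :=
  finrank_inf_ker_add _ _ _ (fun _ hu => raise_mem_harm hu) fun _ hw => exists_raise_eq h hw

theorem finrank_harm_inf_ker_lower {p k : ℤ} (h : p ≤ k + 1) :
    Module.finrank ℝ (Harm ι p k ⊓ LinearMap.ker (lower ι) : Submodule ℝ (BiPoly ι)) +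
      Module.finrank ℝ (Harm ι (p - 1) (k + 1)) = Module.finrank ℝ (Harm ι p k) :=
  finrank_inf_ker_add _ _ _ (fun _ hu => lower_mem_harm hu) fun _ hw => exists_lower_eq h hw

variable {a b c : ι}

theorem finrank_harmX_add (a : ι) (p k : ℤ) : Module.finrank ℝ (HarmX ι p k) +
    Module.finrank ℝ (Bihom ι p (k - 2)) = Module.finrank ℝ (Bihom ι p k) := by
  classical
  refine finrank_inf_ker_add _ _ _ (fun _ hu => lapX_mem_bihom hu) fun w hw => ?_
  rw [bihom_eq_filt (leadWeight_nonneg a a a)] at hw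
  -- Only the index `a` matters for `lapX`, so no distinctness is needed here.
  obtain ⟨u, hu, hu'⟩ := exists_lapX_eq a a a hw
  rw [sub_add_cancel] at hu
  refine ⟨u, ?_, hu'⟩
  rw [bihom_eq_filt (leadWeight_nonneg a a a)]
  exact filt_mono (by norm_num) hu

theorem finrank_harmXY_add (hac : a ≠ c) (hbc : b ≠ c) (hab : a ≠ b) (p k : ℤ) :
    Module.finrank ℝ (HarmXY ι p k) + Module.finrank ℝ (HarmX ι (p - 1) (k - 1)) =
      Module.finrank ℝ (HarmX ι p k) := by
  classical
  refine finrank_inf_ker_add _ _ _ (fun u hu => ⟨lapXY_mem_bihom hu.1, ?_⟩) fun w hw => ?_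
  · rw [SetLike.mem_coe, LinearMap.mem_ker, lapX_lapXY, (mem_harmX.1 hu).2, map_zero]
  obtain ⟨hw, hw0⟩ := mem_harmX.1 hw
  rw [bihom_eq_filt (leadWeight_nonneg a b c)] at hw
  obtain ⟨u, hu, hu0, hu'⟩ := exists_lapXY_eq hac hbc hab hw hw0
  rw [sub_add_cancel, sub_add_cancel] at hu
  refine ⟨u, mem_harmX.2 ⟨?_, hu0⟩, hu'⟩
  rw [bihom_eq_filt (leadWeight_nonneg a b c)]
  exact filt_mono (by norm_num) hu

theorem finrank_harm_add (hac : a ≠ c) (hbc : b ≠ c) (hab : a ≠ b) (p k : ℤ) :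
    Module.finrank ℝ (Harm ι p k) + Module.finrank ℝ (HarmXY ι (p - 2) k) =
      Module.finrank ℝ (HarmXY ι p k) := by
  classical
  refine finrank_inf_ker_add _ _ _ (fun u hu => ?_) fun w hw => ?_
  · obtain ⟨h0, h1, h2⟩ := mem_harmXY.1 hu
    exact mem_harmXY.2 ⟨lapY_mem_bihom h0, by rw [lapX_lapY, h1, map_zero],
      by rw [lapXY_lapY, h2, map_zero]⟩
  obtain ⟨hw, hw0, hw1⟩ := mem_harmXY.1 hw
  rw [bihom_eq_filt (leadWeight_nonneg a b c)] at hw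
  obtain ⟨u, hu, hu0, hu1, hu'⟩ := exists_lapY_eq hac hbc hab hw hw0 hw1
  rw [sub_add_cancel] at hu
  refine ⟨u, mem_harmXY.2 ⟨?_, hu0, hu1⟩, hu'⟩
  rwa [bihom_eq_filt (leadWeight_nonneg a b c)]

end Dimensions

/-! ### Dimensions of harmonic polynomials and of the joint kernels. -/

section ClosedForms

/-- The dimension of the space of homogeneous polynomials of degree `k` in `n + 1` variables. -/
def polyDim (n : ℕ) (k : ℤ) : ℤ := if 0 ≤ k then ((n + k.toNat).choose n : ℤ) else 0

/-- The dimension of the space of harmonic polynomials of degree `k` in `n + 1` variables. -/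
def harmDim (n : ℕ) (k : ℤ) : ℤ := polyDim n k - polyDim n (k - 2)

theorem polyDim_natCast (n k : ℕ) : polyDim n k = ((n + k).choose n : ℤ) := by
  simp [polyDim]

theorem polyDim_of_neg (n : ℕ) {k : ℤ} (hk : k < 0) : polyDim n k = 0 := by
  simp [polyDim, hk]

theorem polyDim_cast (n k : ℕ) : (polyDim n k : ℚ) = (n + k)! / (n ! * k !) := by
  rw [polyDim_natCast, Int.cast_natCast, Nat.cast_add_choose]

theorem harmDim_of_neg (n : ℕ) {k : ℤ} (hk : k < 0) : harmDim n k = 0 := by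
  rw [harmDim, polyDim_of_neg n hk, polyDim_of_neg n (by omega), sub_zero]

/-- The degrees `0` and `1` are separate because `polyDim` at `k - 2` is then zero by convention and
not given by factorials. -/
theorem harmDim_cast (m k : ℕ) :
    (harmDim (m + 2) k : ℚ) = (m + k)! * (m + 2 * k + 1) / (k ! * (m + 1)!) := by
  have hm : ((m + 1)! : ℚ) ≠ 0 := by positivity
  match k with
  | 0 =>
    rw [harmDim, polyDim_of_neg _ (by norm_num : ((0 : ℕ) : ℤ) - 2 < 0), sub_zero, polyDim_cast]
    simp only [Nat.add_zero, Nat.factorial_succ, Nat.factorial_zero]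
    push_cast
    field_simp
    ring
  | 1 =>
    rw [harmDim, polyDim_of_neg _ (by norm_num : ((1 : ℕ) : ℤ) - 2 < 0), sub_zero, polyDim_cast]
    simp only [Nat.factorial_succ, Nat.factorial_zero]
    push_cast
    field_simp
  | k + 2 =>
    rw [harmDim, show (((k + 2 : ℕ) : ℤ) - 2) = (k : ℕ) by push_cast; ring, Int.cast_sub,
      polyDim_cast, polyDim_cast, show m + 2 + (k + 2) = m + k + 4 by ring,
      show m + 2 + k = m + k + 2 by ring, show m + (k + 2) = m + k + 2 by ring]
    simp only [Nat.factorial_succ]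
    push_cast
    field_simp
    ring

theorem finrank_bihom (n : ℕ) (p k : ℤ) :
    (Module.finrank ℝ (Bihom (Fin (n + 1)) p k) : ℤ) = polyDim n p * polyDim n k := by
  rcases lt_or_ge p 0 with hp | hp
  · rw [bihom_eq_bot_left hp, polyDim_of_neg n hp]; simp
  rcases lt_or_ge k 0 with hk | hk
  · rw [bihom_eq_bot_right hk, polyDim_of_neg n hk]; simp
  lift p to ℕ using hp
  lift k to ℕ using hk
  rw [finrank_bihom_natCast, polyDim_natCast, polyDim_natCast, Fintype.card_fin, mul_comm,
    show n + 1 + p - 1 = n + p by omega, show n + 1 + k - 1 = n + k by omega,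
    Nat.choose_symm_add, Nat.choose_symm_add]
  push_cast
  rfl

variable {n : ℕ} (hn : 2 ≤ n) (p k : ℤ)

theorem finrank_harmX : (Module.finrank ℝ (HarmX (Fin (n + 1)) p k) : ℤ) =
    Module.finrank ℝ (Bihom (Fin (n + 1)) p k) -
      Module.finrank ℝ (Bihom (Fin (n + 1)) p (k - 2)) := by
  have := finrank_harmX_add (0 : Fin (n + 1)) p k
  omega

include hn

theorem finrank_harmXY : (Module.finrank ℝ (HarmXY (Fin (n + 1)) p k) : ℤ) =
    Module.finrank ℝ (HarmX (Fin (n + 1)) p k) -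
      Module.finrank ℝ (HarmX (Fin (n + 1)) (p - 1) (k - 1)) := by
  have := finrank_harmXY_add (a := (⟨0, by omega⟩ : Fin (n + 1))) (b := ⟨1, by omega⟩)
    (c := ⟨2, by omega⟩) (by simp) (by simp) (by simp) p k
  omega

theorem finrank_harm : (Module.finrank ℝ (Harm (Fin (n + 1)) p k) : ℤ) =
    Module.finrank ℝ (HarmXY (Fin (n + 1)) p k) -
      Module.finrank ℝ (HarmXY (Fin (n + 1)) (p - 2) k) := by
  have := finrank_harm_add (a := (⟨0, by omega⟩ : Fin (n + 1))) (b := ⟨1, by omega⟩)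
    (c := ⟨2, by omega⟩) (by simp) (by simp) (by simp) p k
  omega

/-- On generating functions the three recursions multiply the product series of `polyDim` by `(1 -
t²)(1 - st)(1 - s²)`. The outer factors turn each `polyDim` into `harmDim`, and `1 - st` leaves the
displayed difference. -/
theorem finrank_harm_eq : (Module.finrank ℝ (Harm (Fin (n + 1)) p k) : ℤ) =
    harmDim n p * harmDim n k - harmDim n (p - 1) * harmDim n (k - 1) := by
  simp only [finrank_harm hn, finrank_harmXY hn, finrank_harmX, finrank_bihom, harmDim]
  rw [show p - 2 - 1 = p - 1 - 2 by ring]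
  ring

end ClosedForms

/-! ### Factorial forms of the kernel dimensions, by cases on the degrees where negative indices
occur. -/

section KernelClosedForms

/-- The difference of the dimensions of two neighbouring spaces `Harm`. -/
def kerDim (n : ℕ) (p k : ℤ) : ℤ :=
  harmDim n p * harmDim n k - harmDim n (p - 1) * harmDim n (k - 1) -
    (harmDim n (p + 1) * harmDim n (k - 1) - harmDim n p * harmDim n (k - 2))

theorem harmDim_zero (n : ℕ) : harmDim n 0 = 1 := by
  rw [harmDim, polyDim_of_neg n (by norm_num : (0 : ℤ) - 2 < 0)]
  simp [polyDim]

theorem kerDim_zero_right (m p : ℕ) :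
    (kerDim (m + 2) p 0 : ℚ) = (m + p)! * (m + 2 * p + 1) / (p ! * (m + 1)!) := by
  rw [kerDim, harmDim_of_neg _ (by norm_num : (0 : ℤ) - 1 < 0),
    harmDim_of_neg _ (by norm_num : (0 : ℤ) - 2 < 0), harmDim_zero]
  simp [harmDim_cast]

theorem kerDim_one_right (m q : ℕ) :
    (kerDim (m + 2) (q + 1 : ℕ) 1 : ℚ) =
      (m + q)! * (q + 1) * (m + 2 * q + 3) * (m + q + 2) / (m ! * (q + 2)!) := by
  have h1 := harmDim_cast m 1
  rw [kerDim, harmDim_of_neg _ (by norm_num : (1 : ℤ) - 2 < 0), sub_self, harmDim_zero,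
    show ((q + 1 : ℕ) : ℤ) - 1 = (q : ℕ) by push_cast; ring,
    show ((q + 1 : ℕ) : ℤ) + 1 = (q + 2 : ℕ) by push_cast; ring]
  rw [Nat.cast_one] at h1
  simp only [Int.cast_sub, Int.cast_mul, Int.cast_one, Int.cast_zero, h1, harmDim_cast]
  simp only [← add_assoc, Nat.factorial_succ, Nat.factorial_zero]
  push_cast
  have hm : (m ! : ℚ) ≠ 0 := by positivity
  field_simp
  ring

theorem kerDim_add_two (m q j : ℕ) :
    (kerDim (m + 2) (q + 2 : ℕ) (j + 2 : ℕ) : ℚ) =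
      (m + j)! * (m + q + 1)! * (m + q + j + 4) / ((j + 2)! * (q + 3)! * (m + 1)! * m !) *
        (m * (m + 2 * j + 3) * (m + 2 * q + 5) * (q - j + 1)) := by
  rw [kerDim, show ((q + 2 : ℕ) : ℤ) - 1 = (q + 1 : ℕ) by push_cast; ring,
    show ((q + 2 : ℕ) : ℤ) + 1 = (q + 3 : ℕ) by push_cast; ring,
    show ((j + 2 : ℕ) : ℤ) - 1 = (j + 1 : ℕ) by push_cast; ring,
    show ((j + 2 : ℕ) : ℤ) - 2 = (j : ℕ) by push_cast; ring]
  simp only [Int.cast_sub, Int.cast_mul, harmDim_cast]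
  simp only [← add_assoc, Nat.factorial_succ]
  push_cast
  have hm : (m ! : ℚ) ≠ 0 := by positivity
  field_simp
  ring

end KernelClosedForms

/-! ### Symmetric families of components as iterated `y`-derivatives. -/

section IteratedDerivative

variable {ι : Type*} {p : ℕ}

/-- The iterated partial derivative `∂/∂y_{i₁} ⋯ ∂/∂y_{iₚ}`. -/
def iterPd (i : Fin p → ι) : Module.End ℝ (BiPoly ι) :=
  ((List.ofFn i).map fun j => pd (Sum.inr j)).prod

theorem iterPd_zero (i : Fin 0 → ι) : iterPd i = 1 := by simp [iterPd]

theorem iterPd_succ (i : Fin (p + 1) → ι) :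
    iterPd i = pd (Sum.inr (i 0)) * iterPd (fun j => i j.succ) := by simp [iterPd]

theorem iterPd_cons (j : ι) (i : Fin p → ι) :
    iterPd (Fin.cons j i : Fin (p + 1) → ι) = pd (Sum.inr j) * iterPd i := by
  rw [iterPd_succ]; simp

theorem commute_iterPd {T : Module.End ℝ (BiPoly ι)} (h : ∀ j, Commute T (pd (Sum.inr j)))
    (i : Fin p → ι) : Commute T (iterPd i) :=
  Commute.list_prod_right _ _ fun x hx => by
    obtain ⟨j, _, rfl⟩ := List.mem_map.1 hx
    exact h j

theorem iterPd_apply_comm {T : Module.End ℝ (BiPoly ι)} (h : ∀ j, Commute T (pd (Sum.inr j)))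
    (i : Fin p → ι) (F : BiPoly ι) : iterPd i (T F) = T (iterPd i F) :=
  (LinearMap.congr_fun (commute_iterPd h i).eq F).symm

theorem iterPd_comp_perm (σ : Equiv.Perm (Fin p)) (i : Fin p → ι) :
    iterPd (fun j => i (σ j)) = iterPd i := by
  refine List.Perm.prod_eq' ((σ.ofFn_comp_perm i).map _) ?_
  exact List.pairwise_of_forall_mem_list fun x hx y hy => by
    obtain ⟨j, _, rfl⟩ := List.mem_map.1 hx
    obtain ⟨l, _, rfl⟩ := List.mem_map.1 hy
    exact commute_pd _ _

theorem iterPd_mem_bihom {k : ℤ} (i : Fin p → ι) : ∀ {q : ℤ} {F : BiPoly ι}, F ∈ Bihom ι q k →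
    iterPd i F ∈ Bihom ι (q - p) k := by
  induction p with
  | zero => intro q F hF; simpa [iterPd_zero] using hF
  | succ p ih =>
    intro q F hF
    rw [iterPd_succ, Module.End.mul_apply]
    exact pd_mem_bihom (p := q - p) (k := k) _ (by simp [wy, sub_sub]) (by simp [wx]) (ih _ hF)

theorem iterPd_succ' (i : Fin (p + 1) → ι) (F : BiPoly ι) :
    iterPd i F = iterPd (fun j => i j.succ) (pd (Sum.inr (i 0)) F) := by
  rw [iterPd_succ, Module.End.mul_apply, iterPd_apply_comm fun j => commute_pd _ _]

theorem iterPd_eq_zero {q : ℕ} {k : ℤ} (hqp : q < p) (i : Fin p → ι) {F : BiPoly ι}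
    (hF : F ∈ Bihom ι q k) : iterPd i F = 0 := by
  have := iterPd_mem_bihom i hF
  rwa [bihom_eq_bot_left (by omega), Submodule.mem_bot] at this

theorem pd_apply_comm (s t : ι ⊕ ι) (F : BiPoly ι) : pd s (pd t F) = pd t (pd s F) :=
  LinearMap.congr_fun (pd_comm s t) F

/-- Moving `raise` past `∂/∂y_{iⱼ}` costs one term in which that derivative is replaced by
`∂/∂x_{iⱼ}`. When `F` has `y`-degree `p` the first summand vanishes, and the sum is the formula for
`δ*`. -/
theorem iterPd_raise (i : Fin (p + 1) → ι) (F : BiPoly ι) :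
    iterPd i (raise ι F) = raise ι (iterPd i F) +
      ∑ j, pd (Sum.inl (i j)) (iterPd (j.removeNth i) F) := by
  have hp : ∀ (j : ι) (F : BiPoly ι), pd (Sum.inr j) (raise ι F) =
      raise ι (pd (Sum.inr j) F) + pd (Sum.inl j) F := fun j => LinearMap.congr_fun (pd_inr_raise j)
  induction p with
  | zero => simp [iterPd_succ, iterPd_zero, hp]
  | succ p ih =>
    have h0 : ∀ j : Fin (p + 1), iterPd ((Fin.succ j).removeNth i) F =
        pd (Sum.inr (i 0)) (iterPd (j.removeNth fun l => i l.succ) F) := by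
      intro j
      have e : (Fin.succ j).removeNth i =
          (Fin.cons (i 0) (j.removeNth fun l => i l.succ) : Fin (p + 1) → ι) := by
        ext l
        refine Fin.cases ?_ (fun l => ?_) l <;> simp [Fin.removeNth]
      rw [e, iterPd_cons, Module.End.mul_apply]
    rw [iterPd_succ, Module.End.mul_apply, ih, map_add, hp, Module.End.mul_apply,
      Fin.sum_univ_succ (n := p + 1), add_assoc, map_sum]
    congr 2
    refine Finset.sum_congr rfl fun j _ => ?_
    rw [h0, pd_apply_comm]

variable [Fintype ι]

/-- By induction all `∂F/∂yⱼ` vanish, and Euler's identity recovers a nonzero multiple of `F` from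
them. -/
theorem eq_zero_of_iterPd_eq_zero {k : ℤ} : ∀ {p : ℕ} {F : BiPoly ι}, F ∈ Bihom ι p k →
    (∀ i : Fin p → ι, iterPd i F = 0) → F = 0 := by
  intro p
  induction p with
  | zero =>
    intro F _ h
    simpa [iterPd_zero] using h Fin.elim0
  | succ p ih =>
    intro F hF h
    have h1 : ∀ j, pd (Sum.inr j) F = 0 := fun j => by
      refine ih (pd_mem_bihom _ (by simp [wy]) (by simp [wx]) hF) fun i => ?_
      have := h (Fin.cons j i)
      rwa [iterPd_succ'] at this
    have h2 := sum_mulX_pd_inr hF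
    simp only [h1, map_zero, Finset.sum_const_zero] at h2
    have h3 : (((p + 1 : ℕ) : ℤ) : ℝ) ≠ 0 := by exact_mod_cast Nat.succ_ne_zero p
    exact (smul_eq_zero.1 h2.symm).resolve_left h3

/-- The Poincaré lemma for symmetric tensors: a symmetric family of polynomials in `x` is the family
of iterated `y`-derivatives of a polynomial. -/
theorem exists_iterPd_eq {k : ℤ} : ∀ {p : ℕ} (Q : (Fin p → ι) → BiPoly ι),
    (∀ i, Q i ∈ Bihom ι 0 k) → (∀ (σ : Equiv.Perm (Fin p)) i, Q (fun j => i (σ j)) = Q i) →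
    ∃ F ∈ Bihom ι p k, ∀ i, iterPd i F = Q i := by
  classical
  intro p
  induction p with
  | zero =>
    intro Q hQ _
    refine ⟨Q Fin.elim0, by simpa using hQ _, fun i => ?_⟩
    rw [iterPd_zero, Module.End.one_apply, Subsingleton.elim i]
  | succ p ih =>
    intro Q hQ hσ
    have h1 : ∀ j : ι, ∃ F ∈ Bihom ι p k, ∀ i : Fin p → ι,
        iterPd i F = Q (Fin.cons j i : Fin (p + 1) → ι) := fun j =>
      ih (fun i => Q (Fin.cons j i : Fin (p + 1) → ι)) (fun i => hQ _) fun σ i => by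
        -- This permutation fixes `0` and acts as `σ` on the remaining indices.
        rw [← hσ (Equiv.Perm.decomposeFin.symm (0, σ)) (Fin.cons j i : Fin (p + 1) → ι)]
        congr 1
        ext l
        refine Fin.cases ?_ (fun l => ?_) l <;> simp
    choose G hG hG' using h1
    -- `G j` is the candidate for `∂F/∂yⱼ`. Closedness follows from symmetry of `Q` under exchanging
    -- its first two indices; for `p = 0` both sides have `y`-degree `-1`.
    have hcross : ∀ m j, pd (Sum.inr m) (G j) = pd (Sum.inr j) (G m) := by
      intro m j
      rw [← sub_eq_zero]
      have hmem : ∀ m j, pd (Sum.inr m) (G j) ∈ Bihom ι ((p : ℤ) - 1) k := fun m j =>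
        pd_mem_bihom _ (by simp [wy]) (by simp [wx]) (hG j)
      have hsub := Submodule.sub_mem _ (hmem m j) (hmem j m)
      cases p with
      | zero =>
        rwa [bihom_eq_bot_left (by norm_num), Submodule.mem_bot] at hsub
      | succ q =>
        rw [show ((q + 1 : ℕ) : ℤ) - 1 = q by push_cast; ring] at hsub
        refine eq_zero_of_iterPd_eq_zero hsub fun i => ?_
        have e : ∀ m j, iterPd i (pd (Sum.inr m) (G j)) =
            Q (Fin.cons j (Fin.cons m i : Fin (q + 1) → ι) : Fin (q + 2) → ι) := fun m j => by
          rw [← hG' j, iterPd_succ']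
          simp
        rw [map_sub, e, e, sub_eq_zero, ← hσ (Equiv.swap 0 1)]
        congr 1
        ext l
        refine Fin.cases ?_ (fun l => ?_) l
        · simp
        · refine Fin.cases ?_ (fun l => ?_) l
          · simp
          · rw [Equiv.swap_apply_of_ne_of_ne (Fin.succ_ne_zero _)]
            · rfl
            · exact fun h => Fin.succ_ne_zero l (Fin.succ_injective _ h)
    have hp1 : ((p : ℝ) + 1) ≠ 0 := by positivity
    -- The witness is forced by Euler's identity in `y`-degree `p + 1`.
    refine ⟨((p : ℝ) + 1)⁻¹ • ∑ j, mulX (Sum.inr j) (G j), ?_, fun i => ?_⟩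
    · exact Submodule.smul_mem _ _ (Submodule.sum_mem _ fun j _ =>
        mulX_mem_bihom _ (by simp [wy]) (by simp [wx]) (hG j))
    · have hd : ∀ m, pd (Sum.inr m) (((p : ℝ) + 1)⁻¹ • ∑ j, mulX (Sum.inr j) (G j)) = G m := by
        intro m
        -- After using closedness, summing over `j` gives `p • G m` by Euler's identity, plus one
        -- further `G m`.
        have e : ∀ j, pd (Sum.inr m) (mulX (Sum.inr j) (G j)) =
            mulX (Sum.inr j) (pd (Sum.inr j) (G m)) + if m = j then G j else 0 := fun j => by
          have := LinearMap.congr_fun (pd_mul_mulX (Sum.inr m) (Sum.inr j)) (G j)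
          rw [Module.End.mul_apply, LinearMap.add_apply, Module.End.mul_apply, hcross] at this
          rw [this]
          split_ifs <;> simp_all
        have h2 := sum_mulX_pd_inr (hG m)
        rw [map_smul, map_sum, Finset.sum_congr rfl fun j _ => e j, Finset.sum_add_distrib,
          h2, Finset.sum_ite_eq, if_pos (Finset.mem_univ m), Int.cast_natCast,
          show (p : ℝ) • G m + G m = ((p : ℝ) + 1) • G m by rw [add_smul, one_smul], smul_smul, inv_mul_cancel₀ hp1, one_smul]
      rw [iterPd_succ', hd, hG']
      congr 1
      ext l
      refine Fin.cases ?_ (fun l => ?_) l <;> simp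

end IteratedDerivative

/-! ### Polynomials of `y`-degree zero as polynomials in `x` alone. -/

section Evaluation

variable {ι : Type*} {k : ℤ}

theorem isHomogeneous_of_mem_bihom [Fintype ι] {p k : ℤ} {F : BiPoly ι} (hF : F ∈ Bihom ι p k) :
    F.IsHomogeneous (p + k).toNat := by
  have := map_mem_filt (T := (LinearMap.id : BiPoly ι →ₗ[ℝ] BiPoly ι))
    (W := homogeneousSubmodule (ι ⊕ ι) ℝ (p + k).toNat) (fun m h1 h2 _ => by
      refine isHomogeneous_monomial _ ?_
      simp only [Finsupp.weight_eq_sum, Fintype.sum_sum_type, wx, wy, Sum.elim_inl,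
        Sum.elim_inr] at h1 h2
      rw [Finsupp.degree_eq_sum, Fintype.sum_sum_type, ← h1, ← h2]
      simp only [Pi.zero_apply, Pi.one_apply, smul_zero, Finset.sum_const_zero, zero_add, add_zero,
        nsmul_eq_mul, mul_one, ← Nat.cast_sum, ← Nat.cast_add, Int.toNat_natCast]
      exact add_comm _ _) hF
  exact this

theorem eval_eq_eval_zero [Fintype ι] {F : BiPoly ι} (hF : F ∈ Bihom ι 0 k) (x y : ι → ℝ) :
    eval (Sum.elim x y) F = eval (Sum.elim x 0) F := by
  have := map_mem_filt (T := (aeval (R := ℝ) (Sum.elim x y)).toLinearMap -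
    (aeval (R := ℝ) (Sum.elim x 0)).toLinearMap) (W := ⊥) (fun m h1 h2 _ => by
      simp only [Finsupp.weight_eq_sum, Fintype.sum_sum_type, wy, Sum.elim_inl, Sum.elim_inr] at h1
      simp only [Pi.zero_apply, Pi.one_apply, smul_zero, Finset.sum_const_zero, zero_add,
        nsmul_eq_mul, mul_one, ← Nat.cast_sum, Nat.cast_eq_zero, Finset.sum_eq_zero_iff,
        Finset.mem_univ, true_imp_iff] at h1
      rw [Submodule.mem_bot, LinearMap.sub_apply, sub_eq_zero]
      simp [aeval_monomial, Finsupp.prod_fintype, h1]) hF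
  rw [Submodule.mem_bot, LinearMap.sub_apply, sub_eq_zero] at this
  simpa [aeval_eq_eval] using this

theorem eq_zero_of_eval_eq_zero [Fintype ι] {F : BiPoly ι} (hF : F ∈ Bihom ι 0 k)
    (h : ∀ x : ι → ℝ, eval (Sum.elim x 0) F = 0) : F = 0 :=
  MvPolynomial.funext fun z => by
    rw [← Sum.elim_comp_inl_inr z, eval_eq_eval_zero hF, h, map_zero]

theorem rename_inl_mem_bihom [Fintype ι] {k : ℕ} {P : MvPolynomial ι ℝ} (hP : P.IsHomogeneous k) :
    rename Sum.inl P ∈ Bihom ι 0 k := by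
  classical
  rw [P.as_sum, map_sum]
  refine Submodule.sum_mem _ fun d hd => ?_
  rw [rename_monomial]
  have hdk := hP (mem_support_iff.1 hd)
  refine monomial_mem_filt fun _ => ?_
  simp only [Finsupp.weight_eq_sum, Fintype.sum_sum_type, wx, wy, Sum.elim_inl, Sum.elim_inr]
  simp only [Finsupp.mapDomain_apply Sum.inl_injective]
  simp only [Finsupp.weight_eq_sum] at hdk
  have h0 : ∀ j, Finsupp.mapDomain Sum.inl d (Sum.inr j : ι ⊕ ι) = 0 := fun j =>
    Finsupp.mapDomain_of_notMem_range _ _ (by simp)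
  simp [← hdk, h0]

theorem exists_homogeneous_eval_eq [Fintype ι] {k : ℕ} {F : BiPoly ι} (hF : F ∈ Bihom ι 0 k) :
    ∃ P : MvPolynomial ι ℝ, P.IsHomogeneous k ∧ ∀ x, eval (Sum.elim x 0) F = eval x P := by
  refine ⟨aeval (Sum.elim X 0) F, ?_, fun x => ?_⟩
  · have := (isHomogeneous_of_mem_bihom hF).aeval (n := 1)
      (Sum.elim X 0 : ι ⊕ ι → MvPolynomial ι ℝ) (by
        rintro (i | i)
        · exact isHomogeneous_X _ _
        · exact isHomogeneous_zero _ _ _)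
    simpa using this
  · rw [← aeval_eq_eval, ← aeval_eq_eval, ← AlgHom.comp_apply, comp_aeval]
    congr 2
    ext (i | i) <;> simp

end Evaluation

/-! ### The dictionary between polynomials and tensor fields. -/

section Fields

variable {n p : ℕ}

theorem harmXY_le_bihom {ι : Type*} [Fintype ι] {p k : ℤ} : HarmXY ι p k ≤ Bihom ι p k :=
  fun _ h => (mem_harmXY.1 h).1

section FieldOf

/-- The constant tensor `dx_{i₁} ⊗ ⋯ ⊗ dx_{iₚ}`. -/
def basisTensor (i : Fin p → Fin (n + 1)) : E n [×p]→L[ℝ] ℝ :=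
  (ContinuousMultilinearMap.mkPiAlgebra ℝ (Fin p) ℝ).compContinuousLinearMap
    fun j => EuclideanSpace.proj (i j)

theorem basisTensor_apply_e (i i' : Fin p → Fin (n + 1)) :
    basisTensor i (fun j => e n (i' j)) = if i = i' then 1 else 0 := by
  simp only [basisTensor, ContinuousMultilinearMap.compContinuousLinearMap_apply,
    ContinuousMultilinearMap.mkPiAlgebra_apply, EuclideanSpace.coe_proj, e]
  split_ifs with h
  · subst h
    simp
  · obtain ⟨j, hj⟩ := Function.ne_iff.1 h
    exact Finset.prod_eq_zero (Finset.mem_univ j) (by simp [hj])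

/-- Evaluation at the point `(x, 0)`. -/
def evalX (x : E n) : BiPoly (Fin (n + 1)) →ₗ[ℝ] ℝ :=
  (aeval (R := ℝ) (Sum.elim (fun l => x l) 0)).toLinearMap

theorem evalX_apply (x : E n) (P : BiPoly (Fin (n + 1))) :
    evalX x P = eval (Sum.elim (fun l => x l) 0) P := by
  simp [evalX, aeval_eq_eval]

theorem evalX_mulX (x : E n) (l : Fin (n + 1)) (P : BiPoly (Fin (n + 1))) :
    evalX x (mulX (Sum.inl l) P) = x l * evalX x P := by
  simp [evalX_apply, mulX_apply]

theorem hasFDerivAt_evalX (P : BiPoly (Fin (n + 1))) (x : E n) :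
    HasFDerivAt (fun x => evalX x P)
      (∑ l, evalX x (pd (Sum.inl l) P) • (EuclideanSpace.proj l : E n →L[ℝ] ℝ)) x := by
  induction P using MvPolynomial.induction_on with
  | C a =>
    simp only [evalX_apply, eval_C, pd_apply, pderiv_C, map_zero, zero_smul,
      Finset.sum_const_zero]
    exact hasFDerivAt_const a x
  | add P Q hP hQ =>
    simp only [map_add, add_smul, Finset.sum_add_distrib]
    exact hP.add hQ
  | mul_X P s hP =>
    rcases s with s | s
    · have h1 : HasFDerivAt (fun x : E n => x s) (EuclideanSpace.proj s : E n →L[ℝ] ℝ) x :=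
        (EuclideanSpace.proj s : E n →L[ℝ] ℝ).hasFDerivAt
      have h2 := hP.mul h1
      simp only [evalX_apply, pd_apply, pderiv_mul, map_add, map_mul, eval_X, Sum.elim_inl] at h2 ⊢
      refine HasFDerivAt.congr_fderiv h2 (ContinuousLinearMap.ext fun v => ?_)
      simp only [add_apply, smul_apply, sum_apply, EuclideanSpace.coe_proj, smul_eq_mul, pderiv_X,
        add_mul, Finset.sum_add_distrib, Finset.mul_sum]
      rw [add_comm]
      congr 1
      · exact Finset.sum_congr rfl fun l _ => by ring
      · rw [Finset.sum_eq_single s]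
        · simp
        · intro l _ hl
          simp [hl.symm]
        · simp
    · have h0 : ∀ l, pderiv (Sum.inl l) (X (Sum.inr s) : BiPoly (Fin (n + 1))) = 0 := fun l =>
        pderiv_X_of_ne (by simp)
      simp only [evalX_apply, pd_apply, pderiv_mul, h0, map_mul, eval_X, Sum.elim_inr,
        Pi.zero_apply, mul_zero, add_zero, zero_smul, Finset.sum_const_zero]
      exact hasFDerivAt_const (0 : ℝ) x

theorem contDiff_evalX (P : BiPoly (Fin (n + 1))) : ContDiff ℝ ∞ (fun x : E n => evalX x P) := by
  induction P using MvPolynomial.induction_on with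
  | C a => simp only [evalX_apply, eval_C]; exact contDiff_const
  | add P Q hP hQ => simp only [map_add]; exact hP.add hQ
  | mul_X P s hP =>
    simp only [evalX_apply, map_mul, eval_X] at hP ⊢
    refine hP.mul ?_
    rcases s with s | s
    · exact (EuclideanSpace.proj s : E n →L[ℝ] ℝ).contDiff
    · exact contDiff_const

/-- The symmetric tensor field with components `∂/∂y_{i₁} ⋯ ∂/∂y_{iₚ} F`. -/
def fieldOf (n p : ℕ) : BiPoly (Fin (n + 1)) →ₗ[ℝ] TensorField n p where
  toFun F := ⟨fun x => ∑ i : Fin p → Fin (n + 1), evalX x (iterPd i F) • basisTensor i,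
    ContDiff.sum fun _ _ => (contDiff_evalX _).smul contDiff_const⟩
  map_add' F G := by
    refine Subtype.ext (funext fun x => ?_)
    simp [add_smul, Finset.sum_add_distrib]
  map_smul' c F := by
    refine Subtype.ext (funext fun x => ?_)
    simp [smul_smul, Finset.smul_sum]

theorem fieldOf_apply_e (F : BiPoly (Fin (n + 1))) (x : E n) (i : Fin p → Fin (n + 1)) :
    (fieldOf n p F).1 x (fun j => e n (i j)) = evalX x (iterPd i F) := by
  change (∑ i' : Fin p → Fin (n + 1), evalX x (iterPd i' F) • basisTensor i') _ = _
  rw [sum_apply]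
  simp [basisTensor_apply_e]

theorem multilinear_ext_e {S T : E n [×p]→L[ℝ] ℝ}
    (h : ∀ i : Fin p → Fin (n + 1), S (fun j => e n (i j)) = T (fun j => e n (i j))) : S = T := by
  refine ContinuousMultilinearMap.toMultilinearMap_injective
    (Module.Basis.ext_multilinear (fun _ => (EuclideanSpace.basisFun (Fin (n + 1)) ℝ).toBasis)
      fun i => ?_)
  simpa [e] using h i

theorem tensorField_ext {S T : TensorField n p}
    (h : ∀ x (i : Fin p → Fin (n + 1)), S.1 x (fun j => e n (i j)) = T.1 x (fun j => e n (i j))) :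
    S = T :=
  Subtype.ext (funext fun x => multilinear_ext_e (h x))

theorem cons_e (l : Fin (n + 1)) (i : Fin p → Fin (n + 1)) :
    (Fin.cons (e n l) (fun j => e n (i j)) : Fin (p + 1) → E n) =
      fun j => e n ((Fin.cons l i : Fin (p + 1) → Fin (n + 1)) j) := by
  ext1 j
  refine Fin.cases ?_ (fun j => ?_) j <;> simp

theorem fderiv_apply_e {T : TensorField n p} {i : Fin p → Fin (n + 1)} {P : BiPoly (Fin (n + 1))}
    (h : ∀ x, T.1 x (fun j => e n (i j)) = evalX x P) (x : E n) (l : Fin (n + 1)) :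
    fderiv ℝ T.1 x (e n l) (fun j => e n (i j)) = evalX x (pd (Sum.inl l) P) := by
  have h1 := ((ContinuousMultilinearMap.apply ℝ (fun _ : Fin p => E n) ℝ
    (fun j => e n (i j))).hasFDerivAt.comp x (tensorField_differentiable T x).hasFDerivAt)
  have h2 : (ContinuousMultilinearMap.apply ℝ (fun _ : Fin p => E n) ℝ
      (fun j => e n (i j))) ∘ T.1 = fun x => evalX x P := funext h
  rw [h2] at h1
  have h3 := congrArg (fun L : E n →L[ℝ] ℝ => L (e n l)) (h1.unique (hasFDerivAt_evalX P x))
  refine h3.trans ?_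
  rw [sum_apply]
  simp [e]

/-- Inserting `e n l` in the first slot prepends `∂/∂yₗ` to the iterated derivative, and
differentiating along `e n l` is `∂/∂xₗ`. The same two rules give the Laplacian and the trace below.
-/
theorem covDAdj_fieldOf (F : BiPoly (Fin (n + 1))) :
    covDAdj n p (fieldOf n (p + 1) F) = fieldOf n p (-lapXY F) := by
  refine tensorField_ext fun x i => ?_
  rw [covDAdj_apply, fieldOf_apply_e, map_neg, map_neg, lapXY, LinearMap.sum_apply, map_sum, map_sum]
  congr 1
  refine Finset.sum_congr rfl fun l _ => ?_
  rw [cons_e, fderiv_apply_e (fun x => fieldOf_apply_e F x _), Module.End.mul_apply,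
    iterPd_apply_comm fun _ => commute_pd _ _, iterPd_cons, Module.End.mul_apply,
    iterPd_apply_comm fun _ => commute_pd _ _]

theorem covD_apply_cons (T : TensorField n p) (x : E n) (l : Fin (n + 1))
    (i : Fin p → Fin (n + 1)) :
    (covD n p T).1 x (fun j => e n ((Fin.cons l i : Fin (p + 1) → Fin (n + 1)) j)) =
      fderiv ℝ T.1 x (e n l) (fun j => e n (i j)) := by
  rw [covD_apply]
  simp

theorem lichLaplacian_fieldOf (F : BiPoly (Fin (n + 1))) :
    lichLaplacian n p (fieldOf n p F) = fieldOf n p (-lapX F) := by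
  refine tensorField_ext fun x i => ?_
  rw [lichLaplacian, LinearMap.comp_apply, covDAdj_apply, fieldOf_apply_e, map_neg, map_neg, lapX,
    LinearMap.sum_apply, map_sum, map_sum]
  congr 1
  refine Finset.sum_congr rfl fun l _ => ?_
  rw [cons_e, fderiv_apply_e (P := pd (Sum.inl l) (iterPd i F)) (fun x => by
      rw [covD_apply_cons, fderiv_apply_e (fun x => fieldOf_apply_e F x _)]),
    Module.End.mul_apply, iterPd_apply_comm fun _ => commute_pd _ _,
    iterPd_apply_comm fun _ => commute_pd _ _]

theorem trace_fieldOf (F : BiPoly (Fin (n + 1))) :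
    trace n (p + 2) (fieldOf n (p + 2) F) = fieldOf n p (lapY F) := by
  refine tensorField_ext fun x (i : Fin p → Fin (n + 1)) => ?_
  refine (trace_apply _ x _).trans (Eq.trans ?_ (fieldOf_apply_e (p := p) _ x i).symm)
  rw [lapY, LinearMap.sum_apply, map_sum, map_sum]
  refine Finset.sum_congr rfl fun l _ => ?_
  change (fieldOf n (p + 2) F).1 x (Fin.cons (e n l)
    (Fin.cons (e n l) (fun j : Fin p => e n (i j)) : Fin (p + 1) → E n)) = _
  rw [cons_e, cons_e, fieldOf_apply_e, iterPd_cons, iterPd_cons, Module.End.mul_apply,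
    Module.End.mul_apply, Module.End.mul_apply, iterPd_apply_comm fun _ => commute_pd _ _,
    iterPd_apply_comm fun _ => commute_pd _ _]

theorem sum_smul_e (x : E n) : ∑ l, x l • e n l = x := by
  have := (EuclideanSpace.basisFun (Fin (n + 1)) ℝ).sum_repr x
  simpa [e] using this

/-- Expanding `x = ∑ xₗ eₗ` produces the operator `∑ xₗ ∂/∂yₗ`, which commutes with all
`y`-derivatives. -/
theorem radialContr_fieldOf (F : BiPoly (Fin (n + 1))) :
    radialContr n (p + 1) (fieldOf n (p + 1) F) = fieldOf n p (lower (Fin (n + 1)) F) := by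
  refine tensorField_ext fun x (i : Fin p → Fin (n + 1)) => ?_
  refine Eq.trans ?_ (fieldOf_apply_e (p := p) _ x i).symm
  rw [iterPd_apply_comm fun j => (pd_inr_lower j).symm, lower_eq_sum, LinearMap.sum_apply, map_sum]
  change ((fieldOf n (p + 1) F).1 x).curryLeft x (fun j : Fin p => e n (i j)) = _
  have hx : ((fieldOf n (p + 1) F).1 x).curryLeft x =
      ∑ l, x l • ((fieldOf n (p + 1) F).1 x).curryLeft (e n l) := by
    have := map_sum ((fieldOf n (p + 1) F).1 x).curryLeft (fun l => x l • e n l) Finset.univ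
    rw [sum_smul_e] at this
    simpa using this
  rw [hx, sum_apply]
  refine Finset.sum_congr rfl fun l _ => ?_
  rw [Module.End.mul_apply, evalX_mulX, smul_apply, ContinuousMultilinearMap.curryLeft_apply,
    cons_e, fieldOf_apply_e, iterPd_cons, Module.End.mul_apply, smul_eq_mul]

theorem symDeriv_fieldOf {k : ℤ} {F : BiPoly (Fin (n + 1))} (hF : F ∈ Bihom (Fin (n + 1)) p k) :
    symDeriv n p (fieldOf n p F) = fieldOf n (p + 1) (raise (Fin (n + 1)) F) := by
  refine tensorField_ext fun x i => ?_
  rw [fieldOf_apply_e, iterPd_raise, iterPd_eq_zero (Nat.lt_succ_self p) i hF, map_zero, zero_add,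
    map_sum, symDeriv_apply]
  refine Finset.sum_congr rfl fun l _ => ?_
  exact fderiv_apply_e (i := l.removeNth i) (fun x => fieldOf_apply_e F x _) x (i l)

/-- The components have `y`-degree `0`, so evaluating them at `y = 0` loses nothing. -/
theorem fieldOf_eq_zero {k : ℤ} {F : BiPoly (Fin (n + 1))} (hF : F ∈ Bihom (Fin (n + 1)) p k) :
    fieldOf n p F = 0 ↔ F = 0 := by
  refine ⟨fun h => ?_, fun h => by rw [h, map_zero]⟩
  refine eq_zero_of_iterPd_eq_zero hF fun i => ?_
  have hi := iterPd_mem_bihom i hF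
  rw [sub_self] at hi
  refine eq_zero_of_eval_eq_zero hi fun f => ?_
  have h1 := fieldOf_apply_e F (WithLp.toLp 2 f) i
  rw [h, evalX_apply] at h1
  exact h1.symm

theorem map_fieldOf_bihom (n p k : ℕ) :
    (Bihom (Fin (n + 1)) (p : ℤ) (k : ℤ)).map (fieldOf n p) = SP n p k := by
  ext T
  constructor
  · rintro ⟨F, hF, rfl⟩
    refine ⟨fun x σ => ?_, fun i => ?_⟩
    · have : ((fieldOf n p F).1 x).domDomCongr σ = (fieldOf n p F).1 x :=
        multilinear_ext_e fun i => by
          rw [ContinuousMultilinearMap.domDomCongr_apply, fieldOf_apply_e,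
            fieldOf_apply_e, iterPd_comp_perm]
      intro X
      exact DFunLike.congr_fun this X
    · have hi := iterPd_mem_bihom i hF
      rw [sub_self] at hi
      obtain ⟨P, hP, hP'⟩ := exists_homogeneous_eval_eq hi
      exact ⟨P, hP, fun x => by rw [fieldOf_apply_e, evalX_apply, hP']⟩
  · rintro ⟨hs, hT⟩
    choose P hP hP' using hT
    -- The component polynomials inherit the symmetry of the tensor because a real polynomial is
    -- determined by its values.
    obtain ⟨F, hF, hF'⟩ := exists_iterPd_eq (fun i => rename Sum.inl (P i))
      (fun i => rename_inl_mem_bihom (hP i)) (fun σ i => by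
        congr 1
        refine MvPolynomial.funext fun f => ?_
        have h1 := hP' (fun j => i (σ j)) (WithLp.toLp 2 f)
        have h2 := hP' i (WithLp.toLp 2 f)
        exact h1.symm.trans ((hs (WithLp.toLp 2 f) σ fun j => e n (i j)).trans h2))
    refine ⟨F, hF, tensorField_ext fun x i => ?_⟩
    rw [fieldOf_apply_e, hF', hP', evalX_apply, eval_rename]
    rfl

/-- Transports the conditions one at a time along `Bihom`, `HarmX`, `HarmXY`, `Harm`. -/
theorem map_inf_ker {N : Type*} [AddCommMonoid N] [Module ℝ N] {p : ℕ}
    {U : Submodule ℝ (BiPoly (Fin (n + 1)))}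
    {S : Module.End ℝ (BiPoly (Fin (n + 1)))} {S' : TensorField n p →ₗ[ℝ] N}
    (h : ∀ F ∈ U, S' (fieldOf n p F) = 0 ↔ S F = 0) :
    (U ⊓ LinearMap.ker S).map (fieldOf n p) = U.map (fieldOf n p) ⊓ LinearMap.ker S' := by
  ext T
  constructor
  · rintro ⟨F, hF, rfl⟩
    exact ⟨⟨F, hF.1, rfl⟩, (h F hF.1).2 hF.2⟩
  · rintro ⟨⟨F, hF, rfl⟩, hT⟩
    exact ⟨F, ⟨hF, (h F hF).1 hT⟩, rfl⟩

theorem lichLaplacian_fieldOf_eq_zero {k : ℤ} {F : BiPoly (Fin (n + 1))}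
    (hF : F ∈ Bihom (Fin (n + 1)) p k) : lichLaplacian n p (fieldOf n p F) = 0 ↔ lapX F = 0 := by
  rw [lichLaplacian_fieldOf, fieldOf_eq_zero (Submodule.neg_mem _ (lapX_mem_bihom hF)), neg_eq_zero]

/-- For `p = 0`, `lapXY F` has negative `y`-degree and so vanishes, in agreement with the convention
for functions. The trace and the radial contraction are handled likewise in low degree. -/
theorem divergence_fieldOf_eq_zero {k : ℤ} {F : BiPoly (Fin (n + 1))}
    (hF : F ∈ Bihom (Fin (n + 1)) p k) : divergence n p (fieldOf n p F) = 0 ↔ lapXY F = 0 := by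
  have h := lapXY_mem_bihom hF
  match p with
  | 0 =>
    rw [bihom_eq_bot_left (by norm_num), Submodule.mem_bot] at h
    simp [divergence, h]
  | p + 1 =>
    rw [show ((p + 1 : ℕ) : ℤ) - 1 = p by push_cast; ring] at h
    change covDAdj n p (fieldOf n (p + 1) F) = 0 ↔ _
    rw [covDAdj_fieldOf, fieldOf_eq_zero (Submodule.neg_mem _ h), neg_eq_zero]

theorem trace_fieldOf_eq_zero {k : ℤ} {F : BiPoly (Fin (n + 1))}
    (hF : F ∈ Bihom (Fin (n + 1)) p k) : trace n p (fieldOf n p F) = 0 ↔ lapY F = 0 := by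
  have h := lapY_mem_bihom hF
  match p with
  | 0 =>
    rw [bihom_eq_bot_left (by norm_num), Submodule.mem_bot] at h
    simp [trace, h]
  | 1 =>
    rw [bihom_eq_bot_left (by norm_num), Submodule.mem_bot] at h
    simp [trace, h]
  | p + 2 =>
    rw [show ((p + 2 : ℕ) : ℤ) - 2 = p by push_cast; ring] at h
    rw [trace_fieldOf]
    exact fieldOf_eq_zero h

theorem radialContr_fieldOf_eq_zero {k : ℤ} {F : BiPoly (Fin (n + 1))}
    (hF : F ∈ Bihom (Fin (n + 1)) p k) :
    radialContr n p (fieldOf n p F) = 0 ↔ lower (Fin (n + 1)) F = 0 := by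
  have h := lower_mem_bihom hF
  match p with
  | 0 =>
    rw [bihom_eq_bot_left (by norm_num), Submodule.mem_bot] at h
    simp [radialContr, h]
  | p + 1 =>
    rw [show ((p + 1 : ℕ) : ℤ) - 1 = p by push_cast; ring] at h
    rw [radialContr_fieldOf]
    exact fieldOf_eq_zero h

theorem symDeriv_fieldOf_eq_zero {k : ℤ} {F : BiPoly (Fin (n + 1))}
    (hF : F ∈ Bihom (Fin (n + 1)) p k) :
    symDeriv n p (fieldOf n p F) = 0 ↔ raise (Fin (n + 1)) F = 0 := by
  have h := raise_mem_bihom hF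
  rw [symDeriv_fieldOf hF]
  exact fieldOf_eq_zero (p := p + 1) (by push_cast; exact h)

theorem map_fieldOf_harmX (n p k : ℕ) :
    (HarmX (Fin (n + 1)) (p : ℤ) (k : ℤ)).map (fieldOf n p) =
      SP n p k ⊓ LinearMap.ker (lichLaplacian n p) :=
  (map_inf_ker (U := Bihom (Fin (n + 1)) p k) (S := lapX) (S' := lichLaplacian n p)
    fun _ hF => lichLaplacian_fieldOf_eq_zero hF).trans (by rw [map_fieldOf_bihom])

theorem map_fieldOf_harmXY (n p k : ℕ) :
    (HarmXY (Fin (n + 1)) (p : ℤ) (k : ℤ)).map (fieldOf n p) = SHδ n p k :=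
  (map_inf_ker (U := HarmX (Fin (n + 1)) p k) (S := lapXY) (S' := divergence n p)
    fun _ hF => divergence_fieldOf_eq_zero (mem_harmX.1 hF).1).trans
      (by rw [map_fieldOf_harmX, SHδ])

theorem map_fieldOf_harm (n p k : ℕ) :
    (Harm (Fin (n + 1)) (p : ℤ) (k : ℤ)).map (fieldOf n p) = SHδ0 n p k :=
  (map_inf_ker (U := HarmXY (Fin (n + 1)) p k) (S := lapY) (S' := trace n p)
    fun _ hF => trace_fieldOf_eq_zero (mem_harmXY.1 hF).1).trans
      (by rw [map_fieldOf_harmXY, SHδ0])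

theorem map_fieldOf_harm_inf_ker_raise (n p k : ℕ) :
    (Harm (Fin (n + 1)) (p : ℤ) (k : ℤ) ⊓ LinearMap.ker (raise (Fin (n + 1)))).map (fieldOf n p) =
      SHδ0KerSymDeriv n p k :=
  (map_inf_ker (U := Harm (Fin (n + 1)) p k) (S := raise _) (S' := symDeriv n p)
    fun _ hF => symDeriv_fieldOf_eq_zero (harm_le_bihom hF)).trans
      (by rw [map_fieldOf_harm, SHδ0KerSymDeriv])

theorem map_fieldOf_harm_inf_ker_lower (n p k : ℕ) :
    (Harm (Fin (n + 1)) (p : ℤ) (k : ℤ) ⊓ LinearMap.ker (lower (Fin (n + 1)))).map (fieldOf n p) =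
      SHδ0KerRadial n p k :=
  (map_inf_ker (U := Harm (Fin (n + 1)) p k) (S := lower _) (S' := radialContr n p)
    fun _ hF => radialContr_fieldOf_eq_zero (harm_le_bihom hF)).trans
      (by rw [map_fieldOf_harm, SHδ0KerRadial])

theorem finrank_map_fieldOf {k : ℤ} {U : Submodule ℝ (BiPoly (Fin (n + 1)))}
    (hU : U ≤ Bihom (Fin (n + 1)) p k) :
    Module.finrank ℝ (U.map (fieldOf n p)) = Module.finrank ℝ U := by
  have h : Function.Injective ((fieldOf n p).domRestrict U) := by
    rw [injective_iff_map_eq_zero]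
    exact fun F hF => Subtype.ext ((fieldOf_eq_zero (hU F.2)).1 hF)
  rw [← LinearMap.range_domRestrict, LinearMap.finrank_range_of_inj h]

end FieldOf

/-! ### Dimensions of the tensor spaces. -/

section Dimensions

theorem finrank_SP (n p k : ℕ) :
    Module.finrank ℝ (SP n p k) = Module.finrank ℝ (Bihom (Fin (n + 1)) p k) := by
  rw [← map_fieldOf_bihom, finrank_map_fieldOf le_rfl]

theorem finrank_SHδ (n p k : ℕ) :
    Module.finrank ℝ (SHδ n p k) = Module.finrank ℝ (HarmXY (Fin (n + 1)) p k) := by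
  rw [← map_fieldOf_harmXY, finrank_map_fieldOf harmXY_le_bihom]

theorem finrank_SHδ0 (n p k : ℕ) :
    Module.finrank ℝ (SHδ0 n p k) = Module.finrank ℝ (Harm (Fin (n + 1)) p k) := by
  rw [← map_fieldOf_harm, finrank_map_fieldOf harm_le_bihom]

theorem finrank_SHδ0KerSymDeriv_add {p k : ℕ} (h : k ≤ p) :
    Module.finrank ℝ (SHδ0KerSymDeriv n p k) +
      Module.finrank ℝ (Harm (Fin (n + 1)) (p + 1) (k - 1)) =
      Module.finrank ℝ (Harm (Fin (n + 1)) p k) := by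
  rw [← map_fieldOf_harm_inf_ker_raise, finrank_map_fieldOf (inf_le_left.trans harm_le_bihom)]
  exact finrank_harm_inf_ker_raise (by omega)

theorem finrank_SHδ0KerRadial_add {p k : ℕ} (h : p ≤ k) :
    Module.finrank ℝ (SHδ0KerRadial n p k) +
      Module.finrank ℝ (Harm (Fin (n + 1)) (p - 1) (k + 1)) =
      Module.finrank ℝ (Harm (Fin (n + 1)) p k) := by
  rw [← map_fieldOf_harm_inf_ker_lower, finrank_map_fieldOf (inf_le_left.trans harm_le_bihom)]
  exact finrank_harm_inf_ker_lower (by omega)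

/-- For negative indices the convention built into `dimZ` matches the vanishing of `Bihom`. -/
theorem dimZ_eq {S : (p : ℕ) → ℕ → Submodule ℝ (TensorField n p)}
    {H : ℤ → ℤ → Submodule ℝ (BiPoly (Fin (n + 1)))}
    (h : ∀ p k : ℕ, Module.finrank ℝ (S p k) = Module.finrank ℝ (H p k))
    (hH : ∀ p k, H p k ≤ Bihom (Fin (n + 1)) p k) (p k : ℤ) :
    dimZ S p k = Module.finrank ℝ (H p k) := by
  unfold dimZ
  split_ifs with hpk
  · rw [h, Int.toNat_of_nonneg hpk.1, Int.toNat_of_nonneg hpk.2]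
  · have : H p k = ⊥ := by
      rw [eq_bot_iff]
      refine (hH p k).trans (le_of_eq ?_)
      rcases lt_or_ge p 0 with hp | hp
      · exact bihom_eq_bot_left hp
      · exact bihom_eq_bot_right (by omega)
    rw [this]
    simp

theorem dimZ_SP (p k : ℤ) :
    dimZ (SP n) p k = Module.finrank ℝ (Bihom (Fin (n + 1)) p k) :=
  dimZ_eq (finrank_SP n) (fun _ _ => le_rfl) p k

theorem dimZ_SHδ (p k : ℤ) :
    dimZ (SHδ n) p k = Module.finrank ℝ (HarmXY (Fin (n + 1)) p k) :=
  dimZ_eq (finrank_SHδ n) (fun _ _ => harmXY_le_bihom) p k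

theorem dimZ_SHδ0 (p k : ℤ) :
    dimZ (SHδ0 n) p k = Module.finrank ℝ (Harm (Fin (n + 1)) p k) :=
  dimZ_eq (finrank_SHδ0 n) (fun _ _ => harm_le_bihom) p k

theorem dimZ_natCast (S : (p : ℕ) → ℕ → Submodule ℝ (TensorField n p)) (p k : ℕ) :
    dimZ S p k = Module.finrank ℝ (S p k) := by
  simp [dimZ]

theorem finrank_SHδ0KerSymDeriv {p k : ℕ} (hn : 2 ≤ n) (h : k ≤ p) :
    (Module.finrank ℝ (SHδ0KerSymDeriv n p k) : ℤ) = kerDim n p k := by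
  have h1 := finrank_SHδ0KerSymDeriv_add (n := n) h
  have h2 := finrank_harm_eq hn p k
  have h3 := finrank_harm_eq hn (p + 1) (k - 1)
  rw [show (p : ℤ) + 1 - 1 = p by ring, show (k : ℤ) - 1 - 1 = k - 2 by ring] at h3
  rw [kerDim, ← h2, ← h3, ← h1]
  push_cast
  ring

/-- The arguments of `kerDim` are exchanged: the formula for `dim Harm` is symmetric in `p` and `k`,
so one closed form serves both kernels. -/
theorem finrank_SHδ0KerRadial {p k : ℕ} (hn : 2 ≤ n) (h : p ≤ k) :
    (Module.finrank ℝ (SHδ0KerRadial n p k) : ℤ) = kerDim n k p := by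
  have h1 := finrank_SHδ0KerRadial_add (n := n) h
  have h2 := finrank_harm_eq hn p k
  have h3 := finrank_harm_eq hn (p - 1) (k + 1)
  rw [show (k : ℤ) + 1 - 1 = k by ring, show (p : ℤ) - 1 - 1 = p - 2 by ring] at h3
  have h4 : (Module.finrank ℝ (SHδ0KerRadial n p k) : ℤ) =
      Module.finrank ℝ (Harm (Fin (n + 1)) p k) -
        Module.finrank ℝ (Harm (Fin (n + 1)) (p - 1) (k + 1)) := by omega
  rw [h4, h2, h3, kerDim]
  ring

end Dimensions

end Fields

theorem finite_SP (n p k : ℕ) : Module.Finite ℝ (SP n p k) := by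
  rw [← map_fieldOf_bihom]
  infer_instance

theorem finrank_SP_cast (n p k : ℕ) : (Module.finrank ℝ (SP n p k) : ℚ) =
    ((n + p)! : ℚ) / (n ! * p !) * (((n + k)! : ℚ) / (n ! * k !)) := by
  rw [finrank_SP, ← polyDim_cast, ← polyDim_cast, ← Int.cast_mul, ← finrank_bihom,
    Int.cast_natCast]

end SphereTensor

end

theorem lemma4p4 (n : ℕ) (hn : 2 ≤ n) :
    -- the spaces are finite-dimensional, and the dimension of `𝒮ᵖPₖ`
    (∀ p k : ℕ, Module.Finite ℝ (SphereTensor.SP n p k) ∧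
      (Module.finrank ℝ (SphereTensor.SP n p k) : ℚ) =
        ((n + p)! : ℚ) / (n ! * p !) * (((n + k)! : ℚ) / (n ! * k !))) ∧
    -- the four dimension formulas
    (∀ p k : ℕ, SphereTensor.dimZ (SphereTensor.SHδ n) p k =
      SphereTensor.dimZ (SphereTensor.SP n) p k
        - SphereTensor.dimZ (SphereTensor.SP n) p (k - 2)
        - SphereTensor.dimZ (SphereTensor.SP n) (p - 1) (k - 1)
        + SphereTensor.dimZ (SphereTensor.SP n) (p - 1) (k - 3)) ∧
    (∀ p k : ℕ, SphereTensor.dimZ (SphereTensor.SHδ0 n) p k =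
      SphereTensor.dimZ (SphereTensor.SHδ n) p k
        - SphereTensor.dimZ (SphereTensor.SHδ n) (p - 2) k) ∧
    (∀ p k : ℕ, k ≤ p → SphereTensor.dimZ (SphereTensor.SHδ0KerSymDeriv n) p k =
      SphereTensor.dimZ (SphereTensor.SHδ0 n) p k
        - SphereTensor.dimZ (SphereTensor.SHδ0 n) (p + 1) (k - 1)) ∧
    (∀ p k : ℕ, p ≤ k → SphereTensor.dimZ (SphereTensor.SHδ0KerRadial n) p k =
      SphereTensor.dimZ (SphereTensor.SHδ0 n) p k
        - SphereTensor.dimZ (SphereTensor.SHδ0 n) (p - 1) (k + 1)) ∧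
    -- the closed forms; no natural-number subtraction below truncates
    (∀ k : ℕ, (Module.finrank ℝ (SphereTensor.SHδ0KerRadial n 0 k) : ℚ) =
      ((n + k - 2)! : ℚ) * (n + 2 * k - 1) / (k ! * (n - 1)!)) ∧
    (∀ p : ℕ, (Module.finrank ℝ (SphereTensor.SHδ0KerSymDeriv n p 0) : ℚ) =
      ((n + p - 2)! : ℚ) * (n + 2 * p - 1) / (p ! * (n - 1)!)) ∧
    (∀ k : ℕ, 1 ≤ k → (Module.finrank ℝ (SphereTensor.SHδ0KerRadial n 1 k) : ℚ) =
      ((n + k - 3)! : ℚ) * k * (n + 2 * k - 1) * (n + k - 1) / ((n - 2)! * (k + 1)!)) ∧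
    (∀ p : ℕ, 1 ≤ p → (Module.finrank ℝ (SphereTensor.SHδ0KerSymDeriv n p 1) : ℚ) =
      ((n + p - 3)! : ℚ) * p * (n + 2 * p - 1) * (n + p - 1) / ((n - 2)! * (p + 1)!)) ∧
    (∀ p k : ℕ, 2 ≤ k → k ≤ p →
      (Module.finrank ℝ (SphereTensor.SHδ0KerSymDeriv n p k) : ℚ) =
      ((n + k - 4)! : ℚ) * (n + p - 3)! * (n + p + k - 2)
        / (k ! * (p + 1)! * (n - 1)! * (n - 2)!)
        * ((n - 2) * (n + 2 * k - 3) * (n + 2 * p - 1) * (p - k + 1))) ∧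
    (∀ p k : ℕ, 2 ≤ p → p ≤ k →
      (Module.finrank ℝ (SphereTensor.SHδ0KerRadial n p k) : ℚ) =
      ((n + k - 3)! : ℚ) * (n + p - 4)! * (n + p + k - 2)
        / ((k + 1)! * p ! * (n - 1)! * (n - 2)!)
        * ((n - 2) * (n + 2 * k - 1) * (n + 2 * p - 3) * (k - p + 1))) := by

  -- Writing `n = m + 2`, and later shifting `p` and `k` by their lower bounds, removes every
  -- truncated subtraction inside the factorials.
  obtain ⟨m, rfl⟩ : ∃ m, n = m + 2 := ⟨n - 2, by omega⟩
  refine ⟨fun p k => ⟨SphereTensor.finite_SP _ p k, SphereTensor.finrank_SP_cast _ p k⟩,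
    fun p k => ?_, fun p k => ?_, fun p k h => ?_, fun p k h => ?_, fun k => ?_, fun p => ?_,
    fun k h => ?_, fun p h => ?_, fun p k hk h => ?_, fun p k hp h => ?_⟩
  · simp only [SphereTensor.dimZ_SP, SphereTensor.dimZ_SHδ, SphereTensor.finrank_harmXY hn,
      SphereTensor.finrank_harmX]
    rw [show (k : ℤ) - 1 - 2 = k - 3 by ring]
    ring
  · rw [SphereTensor.dimZ_SHδ0, SphereTensor.dimZ_SHδ, SphereTensor.dimZ_SHδ,
      SphereTensor.finrank_harm hn]
  · rw [SphereTensor.dimZ_SHδ0, SphereTensor.dimZ_SHδ0, SphereTensor.dimZ_natCast]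
    have := SphereTensor.finrank_SHδ0KerSymDeriv_add (n := m + 2) h
    omega
  · rw [SphereTensor.dimZ_SHδ0, SphereTensor.dimZ_SHδ0, SphereTensor.dimZ_natCast]
    have := SphereTensor.finrank_SHδ0KerRadial_add (n := m + 2) h
    omega
  · rw [← Int.cast_natCast (R := ℚ), SphereTensor.finrank_SHδ0KerRadial hn (Nat.zero_le k)]
    refine (SphereTensor.kerDim_zero_right m k).trans ?_
    rw [show m + 2 + k - 2 = m + k by omega, show m + 2 - 1 = m + 1 by omega]
    push_cast
    ring
  · rw [← Int.cast_natCast (R := ℚ), SphereTensor.finrank_SHδ0KerSymDeriv hn (Nat.zero_le p)]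
    refine (SphereTensor.kerDim_zero_right m p).trans ?_
    rw [show m + 2 + p - 2 = m + p by omega, show m + 2 - 1 = m + 1 by omega]
    push_cast
    ring
  · obtain ⟨j, rfl⟩ : ∃ j, k = j + 1 := ⟨k - 1, by omega⟩
    rw [← Int.cast_natCast (R := ℚ), SphereTensor.finrank_SHδ0KerRadial hn h]
    refine (SphereTensor.kerDim_one_right m j).trans ?_
    rw [show m + 2 + (j + 1) - 3 = m + j by omega, show m + 2 - 2 = m by omega,
      show j + 1 + 1 = j + 2 by omega]
    push_cast
    ring
  · obtain ⟨q, rfl⟩ : ∃ q, p = q + 1 := ⟨p - 1, by omega⟩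
    rw [← Int.cast_natCast (R := ℚ), SphereTensor.finrank_SHδ0KerSymDeriv hn h]
    refine (SphereTensor.kerDim_one_right m q).trans ?_
    rw [show m + 2 + (q + 1) - 3 = m + q by omega, show m + 2 - 2 = m by omega,
      show q + 1 + 1 = q + 2 by omega]
    push_cast
    ring
  · obtain ⟨j, rfl⟩ : ∃ j, k = j + 2 := ⟨k - 2, by omega⟩
    obtain ⟨q, rfl⟩ : ∃ q, p = q + 2 := ⟨p - 2, by omega⟩
    rw [← Int.cast_natCast (R := ℚ), SphereTensor.finrank_SHδ0KerSymDeriv hn h,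
      SphereTensor.kerDim_add_two, show m + 2 + (j + 2) - 4 = m + j by omega,
      show m + 2 + (q + 2) - 3 = m + q + 1 by omega, show m + 2 - 1 = m + 1 by omega,
      show m + 2 - 2 = m by omega, show q + 2 + 1 = q + 3 by omega]
    push_cast
    ring
  · obtain ⟨q, rfl⟩ : ∃ q, k = q + 2 := ⟨k - 2, by omega⟩
    obtain ⟨j, rfl⟩ : ∃ j, p = j + 2 := ⟨p - 2, by omega⟩
    rw [← Int.cast_natCast (R := ℚ), SphereTensor.finrank_SHδ0KerRadial hn h,
      SphereTensor.kerDim_add_two, show m + 2 + (q + 2) - 3 = m + q + 1 by omega,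
      show m + 2 + (j + 2) - 4 = m + j by omega, show m + 2 - 1 = m + 1 by omega,
      show m + 2 - 2 = m by omega, show q + 2 + 1 = q + 3 by omega]
    push_cast
    ring
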